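/- Fix a real number $p>2$ and consider real-valued functions on $\mathbb{R}^2$. Write $\partial_\theta u := x_1\partial_{x_2}u-x_2\partial_{x_1}u$ (weak derivatives) and let $$H:=\Bigl\{u\in H^1(\mathbb{R}^2)\,:\,\int_{\mathbb{R}^2}|\partial_\theta u|^2\,dx<\infty\Bigr\}.$$ For $\lambda>0$ and $u,v\in H$ put $$\langle u,v\rangle_\lambda:=\int_{\mathbb{R}^2}\Bigl(\nabla u\cdot\nabla v+\frac{1}{\lambda^2}(\partial_\theta u)(\partial_\theta v)+uv\Bigr)dx,\qquad E_\lambda(u):=\frac12\langle u,u\rangle_\lambda-\frac1p\int_{\mathbb{R}^2}|u|^p\,dx .$$ A function $u\in H$ is called a weak solution of $$-\Delta u-\frac{1}{\lambda^2}\,\partial_\theta^2u+u=|u|^{p-2}u\quad\text{on }\mathbb{R}^2,\qquad u(x)\to0\ \text{ as }|x|\to\infty, \tag{$P_\lambda$}$$ if $\langle u,v\rangle_\lambda=\int_{\mathbb{R}^2}|u|^{p-2}uv\,dx$ for all $v\in H$. It is called radial if there is a function $f$ with $u(x)=f(|x|)$ for almost every $x\in\mathbb{R}^2$. Let $|u|_\infty\in[0,\infty]$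 denote the essential supremum of $|u|$ (a negative power of $\infty$ being read as $0$). (i) Let $\lambda>0$ and let $u\in H$ be a weak solution of $(P_\lambda)$ which is nontrivial, i.e. does not vanish almost everywhere. If $$\lambda<\Bigl(\frac{1}{(p-1)\,|u|_\infty^{p-2}}\Bigr)^{1/2},$$ then $u$ is radial. (ii) For every $c>0$ there exists $\lambda_c>0$ (which may depend on $c$ and $p$) such that, for every $\lambda\in(0,\lambda_c)$, every weak solution $u\in H$ of $(P_\lambda)$ with $E_\lambda(u)\le c$ is radial. -/

import Mathlib

open MeasureTheory
open scoped ENNReal ContDiff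

namespace SpiralNLS

noncomputable section

/-- The Euclidean plane `ℝ²`, with its Euclidean norm and Lebesgue measure. -/
abbrev Plane : Type := EuclideanSpace ℝ (Fin 2)

/-- `g` is the weak partial derivative of `u` in the `i`-th coordinate direction:
`∫ u ∂ᵢφ = - ∫ g φ` for every test function `φ ∈ C_c^∞(ℝ²)`.
(It is used for `u` and `g` in `L²(ℝ²)` only.) -/
def IsWeakPartial (i : Fin 2) (u g : Plane → ℝ) : Prop :=
  ∀ φ : Plane → ℝ, ContDiff ℝ ∞ φ → HasCompactSupport φ →
    ∫ x, u x * fderiv ℝ φ x (EuclideanSpace.single i 1) = - ∫ x, g x * φ x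

/-- Square-integrable weak partial derivatives are unique almost everywhere. -/
theorem IsWeakPartial.ae_eq {i : Fin 2} {u g g' : Plane → ℝ}
    (hg : MemLp g 2 volume) (hg' : MemLp g' 2 volume)
    (h : IsWeakPartial i u g) (h' : IsWeakPartial i u g') : g =ᵐ[volume] g' := by
  refine ae_eq_of_integral_contDiff_smul_eq (hg.locallyIntegrable (by norm_num))
    (hg'.locallyIntegrable (by norm_num)) fun φ hφ hc => ?_
  have key := (h φ hφ hc).symm.trans (h' φ hφ hc)
  simpa [mul_comm] using key

open Classical in
/-- The weak partial derivative `∂_{xᵢ} u` of a function that has one in `L²(ℝ²)`; it is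
determined up to equality almost everywhere. (The value is `0` if there is none.) -/
def weakPartial (i : Fin 2) (u : Plane → ℝ) : Plane → ℝ :=
  if h : ∃ g : Plane → ℝ, MemLp g 2 volume ∧ IsWeakPartial i u g then h.choose else 0

/-- The choice made in `weakPartial` does not matter. -/
theorem weakPartial_ae_eq {i : Fin 2} {u g : Plane → ℝ}
    (hg : MemLp g 2 volume) (h : IsWeakPartial i u g) : weakPartial i u =ᵐ[volume] g := by
  have hex : ∃ g : Plane → ℝ, MemLp g 2 volume ∧ IsWeakPartial i u g := ⟨g, hg, h⟩
  rw [weakPartial, dif_pos hex]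
  exact IsWeakPartial.ae_eq hex.choose_spec.1 hg hex.choose_spec.2 h

/-- Membership in the Sobolev space `H¹(ℝ²)` of real-valued functions: `u ∈ L²(ℝ²)` and both
weak partial derivatives exist in `L²(ℝ²)`. -/
def MemH1 (u : Plane → ℝ) : Prop :=
  MemLp u 2 volume ∧
    ∀ i : Fin 2, ∃ g : Plane → ℝ, MemLp g 2 volume ∧ IsWeakPartial i u g

/-- The angular derivative `∂_θ u = x₁ ∂_{x₂} u - x₂ ∂_{x₁} u`. -/
def angularDeriv (u : Plane → ℝ) (x : Plane) : ℝ :=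
  x 0 * weakPartial 1 u x - x 1 * weakPartial 0 u x

/-- Membership in the space `H` of all `u ∈ H¹(ℝ²)` with `∫ |∂_θ u|² < ∞`. -/
def MemH (u : Plane → ℝ) : Prop :=
  MemH1 u ∧ MemLp (angularDeriv u) 2 volume

/-- The scalar product
`⟨u, v⟩_λ = ∫ (∇u · ∇v + λ⁻² (∂_θ u) (∂_θ v) + u v) dx` on `H`. -/
def lambdaInner (lam : ℝ) (u v : Plane → ℝ) : ℝ :=
  ∫ x, ((weakPartial 0 u x * weakPartial 0 v x + weakPartial 1 u x * weakPartial 1 v x)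
    + 1 / lam ^ 2 * (angularDeriv u x * angularDeriv v x) + u x * v x)

/-- The energy
`E_λ(u) = ½ ∫ (|∇u|² + λ⁻² |∂_θ u|² + |u|²) dx - (1/p) ∫ |u|^p dx` for `u ∈ H`. -/
def energy (p lam : ℝ) (u : Plane → ℝ) : ℝ :=
  1 / 2 * lambdaInner lam u u - 1 / p * ∫ x, |u x| ^ p

/-- `u ∈ H` is a weak solution of `-Δu - λ⁻² ∂_θ² u + u = |u|^{p-2} u` on `ℝ²`, `u → 0` at
infinity: `⟨u, v⟩_λ = ∫ |u|^{p-2} u v dx` for all `v ∈ H`. -/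
def IsWeakSolution (p lam : ℝ) (u : Plane → ℝ) : Prop :=
  MemH u ∧ ∀ v : Plane → ℝ, MemH v →
    lambdaInner lam u v = ∫ x, |u x| ^ (p - 2) * u x * v x

/-- `u` is radial: up to a null set, `u(x)` depends on `|x|` only. -/
def IsRadial (u : Plane → ℝ) : Prop :=
  ∃ f : ℝ → ℝ, u =ᵐ[volume] fun x => f ‖x‖

end

end SpiralNLS

/-! Compare `u` with its rotated copies. For an angle `β` put `w = u ∘ rot β - u`. The equation is
rotation invariant, so `u ∘ rot β` is again a solution, and testing the difference of the two
equations with `w` gives `⟨w, w⟩_λ = ∫ (f(u ∘ rot β) - f(u)) w`, where `f(t) = |t|^(p-2) t`. On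
almost every circle about the origin `u` and `u ∘ rot β` have the same mean, so `w` has mean zero
there and Wirtinger's inequality gives `∫ w² ≤ ∫ |∂_θ w|²`. The angular term of `⟨w, w⟩_λ` therefore
absorbs `Q ∫ w²` whenever `Q ≤ 1/λ²`. If the right-hand side is at most `Q ∫ w² + θ ‖w‖²_{H¹}` with
`θ < 1`, then `w = 0`; this for every `β` makes `u` radial
(`IsWeakSolution.isRadial_of_forall_lambdaInner_le`).

For (i) the mean value theorem for `f` gives `Q = (p-1) |u|_∞^(p-2)` and `θ = 0`.

For (ii) no bound on `|u|_∞` is needed. Testing the equation with `u` turns the energy bound into an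
`H¹` bound independent of `λ`. Splitting at a level `K`, `|u|^(p-2) ≤ K^(p-2) + K^(p-2-n) |u|^n`
with an integer `n > p`. The first term gives `Q = (p-1) K^(p-2)`; by the Sobolev embedding the
second contributes a multiple of `‖w‖²_{H¹}` whose coefficient tends to `0` as `K → ∞`. Fix `K` so
that `θ = 1/2` works, then take `λ` small. -/

namespace SpiralNLS

/-! ### Sobolev embedding of `H¹(ℝ²)` into `L^{2k}` -/

section Sobolev

open Filter Topology

theorem eLpNorm_two_sq {α E : Type*} [MeasurableSpace α] [ENorm E]
    (f : α → E) (μ : Measure α) : eLpNorm f 2 μ ^ 2 = ∫⁻ x, ‖f x‖ₑ ^ 2 ∂μ := by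
  have h := eLpNorm_nnreal_pow_eq_lintegral (f := f) (μ := μ) (p := 2) (by norm_num)
  have h2 : (((2 : NNReal) : ℝ)) = ((2 : ℕ) : ℝ) := by norm_num
  simp only [h2, ENNReal.rpow_natCast] at h
  simpa using h

/-- Jensen's inequality: `h μ` is a probability measure, on which the `L¹` norm is at most the `L²`
norm. -/
theorem sq_lintegral_mul_le {α : Type*} [MeasurableSpace α] {μ : Measure α} {h k : α → ℝ≥0∞}
    (hh : AEMeasurable h μ) (hk : AEMeasurable k μ) (h1 : ∫⁻ t, h t ∂μ = 1) :
    (∫⁻ t, h t * k t ∂μ) ^ 2 ≤ ∫⁻ t, h t * k t ^ 2 ∂μ := by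
  have hp : IsProbabilityMeasure (μ.withDensity h) :=
    ⟨by rw [withDensity_apply _ MeasurableSet.univ, Measure.restrict_univ, h1]⟩
  have hk' : AEMeasurable k (μ.withDensity h) :=
    hk.mono_ac (withDensity_absolutelyContinuous _ _)
  have := eLpNorm_le_eLpNorm_of_exponent_le (p := 1) (q := 2) (μ := μ.withDensity h)
    (by norm_num) hk'.aestronglyMeasurable
  have h2 := pow_le_pow_left' this 2
  rw [eLpNorm_two_sq, eLpNorm_one_eq_lintegral_enorm] at h2
  simp only [enorm_eq_self] at h2
  rwa [lintegral_withDensity_eq_lintegral_mul₀ hh hk,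
    lintegral_withDensity_eq_lintegral_mul₀ hh (hk.pow_const 2)] at h2

/-- Convolution with a probability density does not increase the `L²` norm. -/
theorem eLpNorm_two_convolution_le {ρ g : Plane → ℝ} (hρ : Continuous ρ) (hρ0 : ∀ x, 0 ≤ ρ x)
    (hρi : Integrable ρ volume) (hρ1 : ∫ x, ρ x = 1) (hg : MemLp g 2 volume) :
    eLpNorm (convolution ρ g (ContinuousLinearMap.lsmul ℝ ℝ) volume) 2 volume
      ≤ eLpNorm g 2 volume := by
  have hm : AEMeasurable (fun q : Plane × Plane => ‖g (q.1 - q.2)‖ₑ) (volume.prod volume) :=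
    (hg.1.comp_quasiMeasurePreserving
      (quasiMeasurePreserving_sub_of_right_invariant volume volume)).enorm
  have hmx : ∀ x, AEMeasurable (fun t => ‖g (x - t)‖ₑ) volume := fun x =>
    (hg.1.comp_quasiMeasurePreserving
      (Measure.measurePreserving_sub_left volume x).quasiMeasurePreserving).enorm
  have hρm : AEMeasurable (fun t => ‖ρ t‖ₑ) volume := hρ.measurable.enorm.aemeasurable
  have h1 : ∫⁻ t, ‖ρ t‖ₑ = 1 := by
    have : ∫⁻ t, ‖ρ t‖ₑ = ENNReal.ofReal (∫ x, ρ x) := by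
      rw [ofReal_integral_eq_lintegral_ofReal hρi (Eventually.of_forall hρ0)]
      exact lintegral_congr fun x => Real.enorm_of_nonneg (hρ0 x)
    rw [this, hρ1, ENNReal.ofReal_one]
  rw [← ENNReal.pow_le_pow_left_iff (n := 2) (by norm_num), eLpNorm_two_sq, eLpNorm_two_sq]
  calc ∫⁻ x, ‖convolution ρ g (ContinuousLinearMap.lsmul ℝ ℝ) volume x‖ₑ ^ 2
      ≤ ∫⁻ x, ∫⁻ t, ‖ρ t‖ₑ * ‖g (x - t)‖ₑ ^ 2 := by
        refine lintegral_mono fun x => ?_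
        refine le_trans ?_ (sq_lintegral_mul_le hρm (hmx x) h1)
        gcongr
        refine (enorm_integral_le_lintegral_enorm _).trans (le_of_eq ?_)
        refine lintegral_congr fun t => ?_
        simp [enorm_mul]
    _ = ∫⁻ t, ∫⁻ x, ‖ρ t‖ₑ * ‖g (x - t)‖ₑ ^ 2 := by
        rw [lintegral_lintegral_swap]
        exact ((hρ.measurable.comp measurable_snd).enorm.aemeasurable).mul (hm.pow_const 2)
    _ = ∫⁻ t, ‖ρ t‖ₑ * ∫⁻ x, ‖g x‖ₑ ^ 2 := by
        refine lintegral_congr fun t => ?_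
        rw [lintegral_const_mul' _ _ (by simp),
          lintegral_sub_right_eq_self (fun x => ‖g x‖ₑ ^ 2) t]
    _ = ∫⁻ x, ‖g x‖ₑ ^ 2 := by
        rw [lintegral_mul_const'' _ hρm, h1, one_mul]

theorem finrank_plane_holderConjugate :
    ((Module.finrank ℝ Plane : ℕ) : NNReal).HolderConjugate 2 := by
  simp only [finrank_euclideanSpace, Fintype.card_fin, Nat.cast_ofNat]
  rw [NNReal.holderConjugate_iff]
  constructor
  · norm_num
  · apply NNReal.eq; push_cast; norm_num

theorem fderiv_pow_succ {φ : Plane → ℝ} (hφ : Differentiable ℝ φ) (k : ℕ) :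
    fderiv ℝ (fun x => φ x ^ (k + 1)) = (k + 1 : ℝ) • fun x => φ x ^ k • fderiv ℝ φ x := by
  ext1 x
  have := (hφ x).hasFDerivAt.pow (k + 1)
  rw [this.fderiv]
  simp [smul_smul]

/-- Powers of compactly supported functions on the plane, controlled by the `H¹` norm. -/
theorem exists_eLpNorm_pow_le_of_hasCompactSupport (k : ℕ) : ∃ C : NNReal, ∀ φ : Plane → ℝ,
    ContDiff ℝ 1 φ → HasCompactSupport φ →
      eLpNorm (fun x => φ x ^ (k + 1)) 2 volume
        ≤ C * (eLpNorm φ 2 volume + eLpNorm (fderiv ℝ φ) 2 volume) ^ (k + 1) := by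
  induction k with
  | zero => exact ⟨1, fun φ _ _ => by simp⟩
  | succ k ih =>
    obtain ⟨C, hC⟩ := ih
    refine ⟨eLpNormLESNormFDerivOneConst (volume : Measure Plane) ((2 : NNReal) : ℝ)
      * ((k + 2 : ℕ) : NNReal) * C, fun φ hφ hc => ?_⟩
    have hsupp : HasCompactSupport fun x => φ x ^ (k + 2) :=
      hc.comp_left (g := fun t : ℝ => t ^ (k + 2)) (by simp)
    -- In dimension two the Gagliardo–Nirenberg–Sobolev inequality bounds the `L²` norm by the `L¹`
    -- norm of the gradient. Applied to `φ^(k+2)`, whose gradient is `(k+2) φ^(k+1) ∇φ`, it leaves a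
    -- product that Cauchy–Schwarz reduces to the previous power.
    have h1 := eLpNorm_le_eLpNorm_fderiv_one (volume : Measure Plane) (hφ.pow (k + 2)) hsupp
      finrank_plane_holderConjugate
    rw [fderiv_pow_succ (hφ.differentiable (by norm_num)) (k + 1)] at h1
    replace h1 := h1.trans_eq (congrArg (_ * ·) (eLpNorm_const_smul ((k + 1 : ℕ) + 1 : ℝ)
      (fun x => φ x ^ (k + 1) • fderiv ℝ φ x) 1 volume))
    have h2 : eLpNorm ((fun x => φ x ^ (k + 1)) • fderiv ℝ φ) 1 volume
        ≤ eLpNorm (fun x => φ x ^ (k + 1)) 2 volume * eLpNorm (fderiv ℝ φ) 2 volume :=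
      eLpNorm_smul_le_mul_eLpNorm (hφ.continuous_fderiv (by norm_num)).aestronglyMeasurable
        (hφ.continuous.pow _).aestronglyMeasurable
    have h3 : ‖((k + 1 : ℕ) + 1 : ℝ)‖ₑ = ((k + 2 : ℕ) : ℝ≥0∞) := by
      rw [show ((k + 1 : ℕ) + 1 : ℝ) = ((k + 2 : ℕ) : ℝ) by push_cast; ring,
        Real.enorm_of_nonneg (by positivity), ENNReal.ofReal_natCast]
    rw [h3] at h1
    set N := eLpNorm φ 2 volume + eLpNorm (fderiv ℝ φ) 2 volume
    set K := eLpNormLESNormFDerivOneConst (volume : Measure Plane) ((2 : NNReal) : ℝ)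
    calc eLpNorm (fun x => φ x ^ (k + 2)) 2 volume
        ≤ K * (((k + 2 : ℕ) : ℝ≥0∞) * eLpNorm ((fun x => φ x ^ (k + 1)) • fderiv ℝ φ) 1 volume) :=
          h1
      _ ≤ K * (((k + 2 : ℕ) : ℝ≥0∞) * ((C * N ^ (k + 1)) * N)) := by
          gcongr
          exact h2.trans (mul_le_mul' (hC φ hφ hc) le_add_self)
      _ = _ := by push_cast; ring

/-- A smooth cutoff function on the plane. -/
theorem exists_cutoff : ∃ (χ : ℕ → Plane → ℝ) (B : NNReal), ∀ n, ContDiff ℝ ∞ (χ n) ∧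
    HasCompactSupport (χ n) ∧ (∀ x, ‖χ n x‖ ≤ 1) ∧ (∀ x, ‖fderiv ℝ (χ n) x‖ ≤ B) ∧
    ∀ x, ‖x‖ ≤ n → χ n x = 1 := by
  let χ : ContDiffBump (0 : Plane) := ⟨1, 2, by norm_num, by norm_num⟩
  have hχ : ContDiff ℝ 1 χ := χ.contDiff
  obtain ⟨B, hB⟩ := (χ.hasCompactSupport.fderiv ℝ).exists_bound_of_continuous
    (hχ.continuous_fderiv (by norm_num))
  -- The dilation factor is at most `1`, so the derivative bound of the single bump serves every
  -- `n`; `n + 1` in place of `n` keeps it meaningful at `n = 0`.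
  refine ⟨fun n x => χ ((n + 1 : ℝ)⁻¹ • x), ⟨B, (norm_nonneg _).trans (hB 0)⟩, fun n => ?_⟩
  have hn : (0 : ℝ) < (n + 1 : ℝ)⁻¹ := by positivity
  have hn1 : (n + 1 : ℝ)⁻¹ ≤ 1 := inv_le_one_of_one_le₀ (by linarith [(n.cast_nonneg : (0:ℝ) ≤ n)])
  refine ⟨χ.contDiff.comp (contDiff_const_smul _), ?_, fun x => ?_, fun x => ?_, fun x hx => ?_⟩
  · exact χ.hasCompactSupport.comp_homeomorph (Homeomorph.smulOfNeZero _ hn.ne')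
  · rw [Real.norm_of_nonneg χ.nonneg]; exact χ.le_one
  · have : HasFDerivAt (fun x => χ ((n + 1 : ℝ)⁻¹ • x))
        ((fderiv ℝ χ ((n + 1 : ℝ)⁻¹ • x)).comp ((n + 1 : ℝ)⁻¹ • ContinuousLinearMap.id ℝ Plane)) x :=
      ((hχ.differentiable (by norm_num)) _).hasFDerivAt.comp x
        ((n + 1 : ℝ)⁻¹ • ContinuousLinearMap.id ℝ Plane).hasFDerivAt
    rw [this.fderiv, ContinuousLinearMap.comp_smul, ContinuousLinearMap.comp_id, norm_smul,
      Real.norm_of_nonneg hn.le]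
    exact (mul_le_of_le_one_left (norm_nonneg _) hn1).trans (hB _)
  · refine χ.one_of_mem_closedBall ?_
    rw [mem_closedBall_zero_iff, norm_smul, Real.norm_of_nonneg hn.le, inv_mul_le_iff₀ (by positivity)]
    show ‖x‖ ≤ (n + 1) * 1
    linarith

/-- Fatou's lemma; it carries the Sobolev bound through the cutoff limit and through the
mollification limit. -/
theorem eLpNorm_pow_le_of_tendsto {k : ℕ} {D : ℝ≥0∞} {v : Plane → ℝ} {w : ℕ → Plane → ℝ}
    (hw : ∀ n, AEStronglyMeasurable (w n) volume)
    (hlim : ∀ᵐ x, Tendsto (fun n => w n x) atTop (𝓝 (v x)))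
    (hD : ∀ n, eLpNorm (fun x => w n x ^ k) 2 volume ≤ D) :
    eLpNorm (fun x => v x ^ k) 2 volume ≤ D := by
  refine (Lp.eLpNorm_lim_le_liminf_eLpNorm (f := fun n x => w n x ^ k)
    (fun n => (hw n).pow k) _ ?_).trans ?_
  · filter_upwards [hlim] with x hx using hx.pow k
  · exact (liminf_le_liminf (Eventually.of_forall hD)).trans (by simp)

/-- By the product rule, multiplying by a cutoff enlarges the `H¹` norm by at most the factor `1 +
B`, uniformly in `n`, so the compactly supported case passes to the limit. -/
theorem exists_eLpNorm_pow_le_of_contDiff (k : ℕ) : ∃ C : NNReal, ∀ v : Plane → ℝ,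
    ContDiff ℝ 1 v →
      eLpNorm (fun x => v x ^ (k + 1)) 2 volume
        ≤ C * (eLpNorm v 2 volume + eLpNorm (fderiv ℝ v) 2 volume) ^ (k + 1) := by
  obtain ⟨C, hC⟩ := exists_eLpNorm_pow_le_of_hasCompactSupport k
  obtain ⟨χ, B, hχ⟩ := exists_cutoff
  refine ⟨C * (1 + B) ^ (k + 1), fun v hv => ?_⟩
  have hχ1 : ∀ n, ContDiff ℝ 1 (χ n) := fun n => (hχ n).1.of_le (by exact_mod_cast le_top)
  have hw : ∀ n, ContDiff ℝ 1 fun x => χ n x * v x := fun n => (hχ1 n).mul hv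
  refine eLpNorm_pow_le_of_tendsto (w := fun n x => χ n x * v x)
    (fun n => (hw n).continuous.aestronglyMeasurable) ?_ fun n => ?_
  · refine Eventually.of_forall fun x => ?_
    refine tendsto_const_nhds.congr' ?_
    filter_upwards [eventually_ge_atTop ⌈‖x‖⌉₊] with n hn
    rw [(hχ n).2.2.2.2 x ((Nat.le_ceil _).trans (by exact_mod_cast hn)), one_mul]
  · refine (hC _ (hw n) ((hχ n).2.1.mul_right)).trans ?_
    have h0 : eLpNorm (fun x => χ n x * v x) 2 volume ≤ eLpNorm v 2 volume := by
      refine eLpNorm_mono fun x => ?_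
      rw [norm_mul]
      exact mul_le_of_le_one_left (norm_nonneg _) ((hχ n).2.2.1 x)
    have h1 : eLpNorm (fderiv ℝ fun x => χ n x * v x) 2 volume
        ≤ eLpNorm (fderiv ℝ v) 2 volume + B * eLpNorm v 2 volume := by
      have : fderiv ℝ (fun x => χ n x * v x)
          = (fun x => χ n x • fderiv ℝ v x) + fun x => v x • fderiv ℝ (χ n) x := by
        ext1 x
        exact fderiv_mul ((hχ1 n).differentiable (by norm_num) x)
          (hv.differentiable (by norm_num) x)
      rw [this]
      have hcv := hv.continuous_fderiv (by norm_num)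
      have hcχ := (hχ1 n).continuous_fderiv (by norm_num)
      refine (eLpNorm_add_le ((hχ1 n).continuous.smul hcv).aestronglyMeasurable
        (hv.continuous.smul hcχ).aestronglyMeasurable (by norm_num)).trans ?_
      refine add_le_add ?_ ?_
      · refine eLpNorm_mono fun x => ?_
        change ‖χ n x • fderiv ℝ v x‖ ≤ _
        rw [norm_smul]
        exact mul_le_of_le_one_left (norm_nonneg _) ((hχ n).2.2.1 x)
      · refine (eLpNorm_le_nnreal_smul_eLpNorm_of_ae_le_mul (c := B)
          (Eventually.of_forall fun x => ?_) 2).trans (le_of_eq rfl)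
        change ‖v x • fderiv ℝ (χ n) x‖₊ ≤ _
        rw [nnnorm_smul, mul_comm]
        exact mul_le_mul' (NNReal.coe_le_coe.1 ((hχ n).2.2.2.1 x)) le_rfl
    calc (C : ℝ≥0∞) * (eLpNorm (fun x => χ n x * v x) 2 volume
          + eLpNorm (fderiv ℝ fun x => χ n x * v x) 2 volume) ^ (k + 1)
        ≤ C * ((1 + B) * (eLpNorm v 2 volume + eLpNorm (fderiv ℝ v) 2 volume)) ^ (k + 1) := by
          gcongr
          calc _ ≤ eLpNorm v 2 volume + (eLpNorm (fderiv ℝ v) 2 volume + B * eLpNorm v 2 volume) :=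
                add_le_add h0 h1
            _ ≤ eLpNorm v 2 volume + (eLpNorm (fderiv ℝ v) 2 volume + B * eLpNorm v 2 volume)
                + B * eLpNorm (fderiv ℝ v) 2 volume := le_self_add
            _ = _ := by ring
      _ = _ := by rw [mul_pow]; push_cast; ring

theorem MemH1.memLp_weakPartial {u : Plane → ℝ} (hu : MemH1 u) (i : Fin 2) :
    MemLp (weakPartial i u) 2 volume := by
  rw [weakPartial, dif_pos (hu.2 i)]
  exact (hu.2 i).choose_spec.1

theorem MemH1.isWeakPartial {u : Plane → ℝ} (hu : MemH1 u) (i : Fin 2) :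
    IsWeakPartial i u (weakPartial i u) := by
  rw [weakPartial, dif_pos (hu.2 i)]
  exact (hu.2 i).choose_spec.2

/-- The `H¹` norm, up to equivalence. -/
noncomputable def h1Norm (u : Plane → ℝ) : ℝ≥0∞ :=
  eLpNorm u 2 volume + (eLpNorm (weakPartial 0 u) 2 volume + eLpNorm (weakPartial 1 u) 2 volume)

/-- The derivative falls on the kernel, and `y ↦ ρ (x - y)` is a test function for the weak
derivative. The sign from the reflection `y ↦ x - y` cancels the sign of integration by parts. -/
theorem fderiv_convolution_apply {ρ u g : Plane → ℝ} {i : Fin 2} (hρ : ContDiff ℝ ∞ ρ)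
    (hρc : HasCompactSupport ρ) (hu : LocallyIntegrable u volume) (hg : IsWeakPartial i u g)
    (x : Plane) :
    fderiv ℝ (convolution ρ u (ContinuousLinearMap.lsmul ℝ ℝ) volume) x
        (EuclideanSpace.single i 1)
      = convolution ρ g (ContinuousLinearMap.lsmul ℝ ℝ) volume x := by
  have hρ1 : ContDiff ℝ 1 ρ := hρ.of_le (by exact_mod_cast le_top)
  set e : Plane := EuclideanSpace.single i 1
  rw [(hρc.hasFDerivAt_convolution_left (ContinuousLinearMap.lsmul ℝ ℝ) hρ1 hu x).fderiv]
  have hint : Integrable (fun t => (ContinuousLinearMap.precompL Plane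
      (ContinuousLinearMap.lsmul ℝ ℝ : ℝ →L[ℝ] ℝ →L[ℝ] ℝ) (fderiv ℝ ρ t)) (u (x - t))) volume :=
    (hρc.fderiv ℝ).convolutionExists_left _ (hρ1.continuous_fderiv (by norm_num)) hu x
  rw [convolution_def, ContinuousLinearMap.integral_apply hint, convolution_def]
  have hsub : ContDiff ℝ ∞ fun y : Plane => x - y := contDiff_const.sub contDiff_id
  have hψc : HasCompactSupport fun y => ρ (x - y) := hρc.comp_homeomorph (Homeomorph.subLeft x)
  have key : ∫ y, u y * fderiv ℝ (fun y => ρ (x - y)) y e = -∫ y, g y * ρ (x - y) :=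
    hg (fun y => ρ (x - y)) (hρ.comp hsub) hψc
  have hd : ∀ y, fderiv ℝ (fun y => ρ (x - y)) y e = - fderiv ℝ ρ (x - y) e := by
    intro y
    have : HasFDerivAt (fun y => ρ (x - y))
        ((fderiv ℝ ρ (x - y)).comp (-ContinuousLinearMap.id ℝ Plane)) y :=
      (hρ1.differentiable (by norm_num) _).hasFDerivAt.comp y
        ((hasFDerivAt_id y).const_sub x)
    rw [this.fderiv]
    simp
  have e1 : ∫ t, (ContinuousLinearMap.precompL Plane
      (ContinuousLinearMap.lsmul ℝ ℝ : ℝ →L[ℝ] ℝ →L[ℝ] ℝ) (fderiv ℝ ρ t)) (u (x - t)) e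
      = ∫ y, u y * fderiv ℝ ρ (x - y) e := by
    rw [← integral_sub_left_eq_self (fun y => u y * fderiv ℝ ρ (x - y) e) volume x]
    refine integral_congr_ae (Eventually.of_forall fun t => ?_)
    simp [ContinuousLinearMap.precompL_apply, mul_comm]
  have e2 : ∫ t, ContinuousLinearMap.lsmul ℝ ℝ (ρ t) (g (x - t)) = ∫ y, g y * ρ (x - y) := by
    rw [← integral_sub_left_eq_self (fun y => g y * ρ (x - y)) volume x]
    refine integral_congr_ae (Eventually.of_forall fun t => ?_)
    simp [mul_comm]
  rw [e1, e2]
  simp only [hd, mul_neg, integral_neg, neg_inj] at key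
  exact key

theorem norm_dual_plane_le (L : Plane →L[ℝ] ℝ) :
    ‖L‖ ≤ ‖L (EuclideanSpace.single 0 1)‖ + ‖L (EuclideanSpace.single 1 1)‖ := by
  refine ContinuousLinearMap.opNorm_le_bound _ (by positivity) fun x => ?_
  have hx : x = x 0 • EuclideanSpace.single 0 1 + x 1 • EuclideanSpace.single 1 1 := by
    ext i; fin_cases i <;> simp
  have h0 : ‖x 0‖ ≤ ‖x‖ := PiLp.norm_apply_le x 0
  have h1 : ‖x 1‖ ≤ ‖x‖ := PiLp.norm_apply_le x 1
  conv_lhs => rw [hx]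
  rw [map_add, map_smul, map_smul, add_mul]
  refine (norm_add_le _ _).trans (add_le_add ?_ ?_)
  · rw [norm_smul, mul_comm]; gcongr
  · rw [norm_smul, mul_comm]; gcongr

/-- The Sobolev embedding of `H¹(ℝ²)` into `L^{2k}(ℝ²)`, `k ≥ 1`. -/
theorem exists_eLpNorm_pow_le_h1Norm (k : ℕ) : ∃ C : NNReal, ∀ u : Plane → ℝ, MemH1 u →
    eLpNorm (fun x => u x ^ (k + 1)) 2 volume ≤ C * h1Norm u ^ (k + 1) := by
  obtain ⟨C, hC⟩ := exists_eLpNorm_pow_le_of_contDiff k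
  refine ⟨C, fun u hu => ?_⟩
  have hul : LocallyIntegrable u volume := hu.1.locallyIntegrable (by norm_num)
  -- The fixed ratio `rOut = 2 * rIn` is what almost everywhere convergence of the mollifications
  -- requires (`K = 2` below).
  let φ : ℕ → ContDiffBump (0 : Plane) := fun n =>
    ⟨1 / (n + 1 : ℝ), 2 * (1 / (n + 1 : ℝ)), by positivity,
      by linarith [show (0 : ℝ) < 1 / (n + 1 : ℝ) by positivity]⟩
  have hφ : Tendsto (fun n => (φ n).rOut) atTop (𝓝 0) := by
    change Tendsto (fun n : ℕ => 2 * (1 / (n + 1 : ℝ))) atTop (𝓝 0)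
    simpa using (tendsto_one_div_add_atTop_nhds_zero_nat (𝕜 := ℝ)).const_mul 2
  let w : ℕ → Plane → ℝ := fun n =>
    convolution ((φ n).normed volume) u (ContinuousLinearMap.lsmul ℝ ℝ) volume
  have hwc : ∀ n, ContDiff ℝ 1 (w n) := fun n =>
    (φ n).hasCompactSupport_normed.contDiff_convolution_left (n := 1) _ (φ n).contDiff_normed hul
  have hbd : ∀ n, ∀ g : Plane → ℝ, MemLp g 2 volume →
      eLpNorm (convolution ((φ n).normed volume) g (ContinuousLinearMap.lsmul ℝ ℝ) volume) 2 volume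
        ≤ eLpNorm g 2 volume := fun n g hg =>
    eLpNorm_two_convolution_le (φ n).continuous_normed (φ n).nonneg_normed
      (φ n).integrable_normed (φ n).integral_normed hg
  refine eLpNorm_pow_le_of_tendsto (w := w) (fun n => (hwc n).continuous.aestronglyMeasurable)
    (ContDiffBump.ae_convolution_tendsto_right_of_locallyIntegrable (K := 2) hφ
      (Eventually.of_forall fun n => le_rfl) hul) fun n => (hC _ (hwc n)).trans ?_
  have hpart : ∀ i, ∀ x, fderiv ℝ (w n) x (EuclideanSpace.single i 1)
      = convolution ((φ n).normed volume) (weakPartial i u)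
        (ContinuousLinearMap.lsmul ℝ ℝ) volume x := fun i x =>
    fderiv_convolution_apply (φ n).contDiff_normed (φ n).hasCompactSupport_normed hul
      (hu.isWeakPartial i) x
  have hcont : ∀ i, Continuous (convolution ((φ n).normed volume) (weakPartial i u)
        (ContinuousLinearMap.lsmul ℝ ℝ) volume) := fun i => by
    have : convolution ((φ n).normed volume) (weakPartial i u)
        (ContinuousLinearMap.lsmul ℝ ℝ) volume
        = fun x => fderiv ℝ (w n) x (EuclideanSpace.single i 1) := by
      ext1 x; rw [hpart]
    rw [this]
    exact ((hwc n).continuous_fderiv (by norm_num)).clm_apply continuous_const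
  have hfd : eLpNorm (fderiv ℝ (w n)) 2 volume
      ≤ eLpNorm (weakPartial 0 u) 2 volume + eLpNorm (weakPartial 1 u) 2 volume := by
    refine (eLpNorm_mono_real (g := (fun x => ‖convolution ((φ n).normed volume) (weakPartial 0 u)
        (ContinuousLinearMap.lsmul ℝ ℝ) volume x‖) + fun x => ‖convolution ((φ n).normed volume)
          (weakPartial 1 u) (ContinuousLinearMap.lsmul ℝ ℝ) volume x‖) fun x => ?_).trans ?_
    · have := norm_dual_plane_le (fderiv ℝ (w n) x)
      rwa [hpart 0, hpart 1] at this
    · refine (eLpNorm_add_le (hcont 0).norm.aestronglyMeasurable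
        (hcont 1).norm.aestronglyMeasurable (by norm_num)).trans ?_
      rw [eLpNorm_norm, eLpNorm_norm]
      exact add_le_add (hbd n _ (hu.memLp_weakPartial 0)) (hbd n _ (hu.memLp_weakPartial 1))
  rw [h1Norm]
  gcongr
  exact hbd n u hu.1

end Sobolev

/-! ### Rotations, and invariance of the scalar product -/

section Rotation

/-- The rotation of the plane by the angle `α`. -/
noncomputable def rot (α : ℝ) : Plane ≃ₗᵢ[ℝ] Plane where
  toFun x := !₂[Real.cos α * x 0 - Real.sin α * x 1, Real.sin α * x 0 + Real.cos α * x 1]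
  invFun x := !₂[Real.cos α * x 0 + Real.sin α * x 1, -Real.sin α * x 0 + Real.cos α * x 1]
  map_add' x y := by ext i; fin_cases i <;> simp <;> ring
  map_smul' c x := by ext i; fin_cases i <;> simp <;> ring
  left_inv x := by
    ext i
    fin_cases i
    · simp; linear_combination (x 0) * Real.sin_sq_add_cos_sq α
    · simp; linear_combination (x 1) * Real.sin_sq_add_cos_sq α
  right_inv x := by
    ext i
    fin_cases i
    · simp; linear_combination (x 0) * Real.sin_sq_add_cos_sq α
    · simp; linear_combination (x 1) * Real.sin_sq_add_cos_sq α
  norm_map' x := by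
    simp only [LinearEquiv.coe_mk, LinearMap.coe_mk, AddHom.coe_mk, EuclideanSpace.norm_eq,
      Fin.sum_univ_two, Real.norm_eq_abs, sq_abs]
    congr 1
    simp
    linear_combination (x 0 ^ 2 + x 1 ^ 2) * Real.sin_sq_add_cos_sq α

@[simp] theorem rot_apply_zero (α : ℝ) (x : Plane) :
    rot α x 0 = Real.cos α * x 0 - Real.sin α * x 1 := rfl

@[simp] theorem rot_apply_one (α : ℝ) (x : Plane) :
    rot α x 1 = Real.sin α * x 0 + Real.cos α * x 1 := rfl

theorem plane_ext {x y : Plane} (h0 : x 0 = y 0) (h1 : x 1 = y 1) : x = y := by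
  ext i; fin_cases i <;> assumption

theorem rot_rot (α β : ℝ) (x : Plane) : rot α (rot β x) = rot (α + β) x := by
  apply plane_ext <;> simp [Real.cos_add, Real.sin_add] <;> ring

@[simp] theorem rot_zero (x : Plane) : rot 0 x = x := by
  apply plane_ext <;> simp

theorem rot_periodic (x : Plane) : Function.Periodic (fun α => rot α x) (2 * Real.pi) := by
  intro α
  apply plane_ext <;> simp

theorem rot_neg_rot (α : ℝ) (x : Plane) : rot (-α) (rot α x) = x := by
  rw [rot_rot, neg_add_cancel, rot_zero]

theorem exists_rot_eq (x : Plane) : ∃ β, x = rot β (!₂[‖x‖, 0]) := by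
  let z : ℂ := ⟨x 0, x 1⟩
  have hz : ‖z‖ = ‖x‖ := by
    rw [Complex.norm_eq_sqrt_sq_add_sq, EuclideanSpace.norm_eq, Fin.sum_univ_two]
    simp [z]
  refine ⟨z.arg, plane_ext ?_ ?_⟩
  · simp [← hz, mul_comm, Complex.norm_mul_cos_arg]; rfl
  · simp [← hz, mul_comm, Complex.norm_mul_sin_arg]; rfl

theorem measurePreserving_rot (α : ℝ) : MeasurePreserving (rot α) volume volume :=
  (rot α).measurePreserving

theorem integral_comp_rot {E : Type*} [NormedAddCommGroup E] [NormedSpace ℝ E]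
    (f : Plane → E) (α : ℝ) : ∫ x, f (rot α x) = ∫ x, f x :=
  (measurePreserving_rot α).integral_comp (rot α).toHomeomorph.measurableEmbedding f

theorem _root_.MeasureTheory.MemLp.comp_rot {p : ℝ≥0∞} {f : Plane → ℝ} (hf : MemLp f p volume) (α : ℝ) :
    MemLp (fun x => f (rot α x)) p volume :=
  hf.comp_measurePreserving (measurePreserving_rot α)

theorem ae_comp_rot {P : Plane → Prop} (h : ∀ᵐ x, P x) (α : ℝ) : ∀ᵐ x, P (rot α x) :=
  (measurePreserving_rot α).quasiMeasurePreserving.ae h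

theorem integrable_mul_of_memLp_two {f g : Plane → ℝ} (hf : MemLp f 2 volume)
    (hg : MemLp g 2 volume) : Integrable (fun x => f x * g x) volume :=
  hf.integrable_mul hg

theorem integrable_mul_test {f φ : Plane → ℝ} (hf : MemLp f 2 volume) (hφ : Continuous φ)
    (hc : HasCompactSupport φ) : Integrable (fun x => f x * φ x) volume :=
  integrable_mul_of_memLp_two hf (hφ.memLp_of_hasCompactSupport hc)

/-- The weak derivative in an arbitrary direction. -/
theorem integral_mul_fderiv_eq {u g₀ g₁ : Plane → ℝ} (hu : MemLp u 2 volume)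
    (hg₀ : MemLp g₀ 2 volume) (hg₁ : MemLp g₁ 2 volume)
    (h₀ : IsWeakPartial 0 u g₀) (h₁ : IsWeakPartial 1 u g₁) {φ : Plane → ℝ}
    (hφ : ContDiff ℝ ∞ φ) (hc : HasCompactSupport φ) (v : Plane) :
    ∫ x, u x * fderiv ℝ φ x v = - ∫ x, (v 0 * g₀ x + v 1 * g₁ x) * φ x := by
  have hv : v = v 0 • EuclideanSpace.single 0 1 + v 1 • EuclideanSpace.single 1 1 := by
    apply plane_ext <;> simp
  have hint : ∀ i, Integrable (fun x => u x * fderiv ℝ φ x (EuclideanSpace.single i 1)) volume :=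
    fun i => integrable_mul_test hu
      ((hφ.continuous_fderiv (by simp)).clm_apply continuous_const)
      (hc.fderiv_apply ℝ _)
  have e1 : ∀ x, u x * fderiv ℝ φ x v
      = v 0 * (u x * fderiv ℝ φ x (EuclideanSpace.single 0 1))
        + v 1 * (u x * fderiv ℝ φ x (EuclideanSpace.single 1 1)) := fun x => by
    conv_lhs => rw [hv]
    simp only [map_add, map_smul, smul_eq_mul]
    ring
  have e2 : ∀ x, (v 0 * g₀ x + v 1 * g₁ x) * φ x = v 0 * (g₀ x * φ x) + v 1 * (g₁ x * φ x) :=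
    fun x => by ring
  simp only [e1, e2]
  rw [integral_add ((hint 0).const_mul _) ((hint 1).const_mul _), integral_const_mul,
    integral_const_mul, integral_add ((integrable_mul_test hg₀ hφ.continuous hc).const_mul _)
      ((integrable_mul_test hg₁ hφ.continuous hc).const_mul _), integral_const_mul,
    integral_const_mul, h₀ φ hφ hc, h₁ φ hφ hc]
  ring

/-- The chain rule by duality: rotations preserve measure, so the rotation can be moved onto the
test function, where differentiation along `e` becomes differentiation along `rot α e`. -/
theorem IsWeakPartial.comp_rot {u g₀ g₁ : Plane → ℝ} (hu : MemLp u 2 volume)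
    (hg₀ : MemLp g₀ 2 volume) (hg₁ : MemLp g₁ 2 volume)
    (h₀ : IsWeakPartial 0 u g₀) (h₁ : IsWeakPartial 1 u g₁) (α : ℝ) (i : Fin 2) :
    IsWeakPartial i (fun x => u (rot α x)) (fun x =>
      rot α (EuclideanSpace.single i 1) 0 * g₀ (rot α x)
        + rot α (EuclideanSpace.single i 1) 1 * g₁ (rot α x)) := by
  intro φ hφ hc
  set e : Plane := EuclideanSpace.single i 1
  let ψ : Plane → ℝ := fun x => φ ((rot α).symm x)
  have hψ : ContDiff ℝ ∞ ψ := hφ.comp (rot α).symm.contDiff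
  have hψc : HasCompactSupport ψ := hc.comp_homeomorph (rot α).symm.toHomeomorph
  have hφψ : φ = fun x => ψ (rot α x) := by ext1 x; simp [ψ]
  have hd : ∀ x, fderiv ℝ φ x e = fderiv ℝ ψ (rot α x) (rot α e) := fun x => by
    have : HasFDerivAt φ ((fderiv ℝ ψ (rot α x)).comp
        ((rot α).toContinuousLinearEquiv : Plane →L[ℝ] Plane)) x := by
      conv => enter [1]; rw [hφψ]
      exact (hψ.differentiable (by simp) _).hasFDerivAt.comp x
        (rot α).toContinuousLinearEquiv.hasFDerivAt
    rw [this.fderiv]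
    rfl
  have e1 : ∫ x, u (rot α x) * fderiv ℝ φ x e = ∫ x, u x * fderiv ℝ ψ x (rot α e) := by
    rw [← integral_comp_rot (fun x => u x * fderiv ℝ ψ x (rot α e)) α]
    simp only [hd]
  rw [e1, integral_mul_fderiv_eq hu hg₀ hg₁ h₀ h₁ hψ hψc, ← integral_comp_rot _ α]
  simp [ψ]

theorem MemH1.comp_rot {u : Plane → ℝ} (hu : MemH1 u) (α : ℝ) :
    MemH1 fun x => u (rot α x) :=
  ⟨hu.1.comp_rot α, fun i => ⟨_, (((hu.memLp_weakPartial 0).comp_rot α).const_mul _).add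
    (((hu.memLp_weakPartial 1).comp_rot α).const_mul _),
    IsWeakPartial.comp_rot hu.1 (hu.memLp_weakPartial 0) (hu.memLp_weakPartial 1)
      (hu.isWeakPartial 0) (hu.isWeakPartial 1) α i⟩⟩

theorem MemH1.weakPartial_comp_rot {u : Plane → ℝ} (hu : MemH1 u) (α : ℝ) (i : Fin 2) :
    weakPartial i (fun x => u (rot α x)) =ᵐ[volume] fun x =>
      rot α (EuclideanSpace.single i 1) 0 * weakPartial 0 u (rot α x)
        + rot α (EuclideanSpace.single i 1) 1 * weakPartial 1 u (rot α x) :=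
  weakPartial_ae_eq ((((hu.memLp_weakPartial 0).comp_rot α).const_mul _).add
    (((hu.memLp_weakPartial 1).comp_rot α).const_mul _))
    (IsWeakPartial.comp_rot hu.1 (hu.memLp_weakPartial 0) (hu.memLp_weakPartial 1)
      (hu.isWeakPartial 0) (hu.isWeakPartial 1) α i)

theorem MemH1.angularDeriv_comp_rot {u : Plane → ℝ} (hu : MemH1 u) (α : ℝ) :
    angularDeriv (fun x => u (rot α x)) =ᵐ[volume] fun x => angularDeriv u (rot α x) := by
  filter_upwards [hu.weakPartial_comp_rot α 0, hu.weakPartial_comp_rot α 1] with x h0 h1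
  rw [angularDeriv, h0, h1, angularDeriv]
  simp
  ring

theorem MemH.comp_rot {u : Plane → ℝ} (hu : MemH u) (α : ℝ) : MemH fun x => u (rot α x) :=
  ⟨hu.1.comp_rot α, (hu.2.comp_rot α).ae_eq (hu.1.angularDeriv_comp_rot α).symm⟩

theorem lambdaInner_comp_rot {u v : Plane → ℝ} (hu : MemH1 u) (hv : MemH1 v) (lam α : ℝ) :
    lambdaInner lam (fun x => u (rot α x)) (fun x => v (rot α x)) = lambdaInner lam u v := by
  rw [lambdaInner, lambdaInner]
  refine Eq.trans ?_ (integral_comp_rot _ α)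
  refine integral_congr_ae ?_
  filter_upwards [hu.weakPartial_comp_rot α 0, hu.weakPartial_comp_rot α 1,
    hv.weakPartial_comp_rot α 0, hv.weakPartial_comp_rot α 1, hu.angularDeriv_comp_rot α,
    hv.angularDeriv_comp_rot α] with x h1 h2 h3 h4 h5 h6
  rw [h1, h2, h3, h4, h5, h6]
  simp
  -- The gradients of both functions are transformed by the same orthogonal matrix, so their inner
  -- product is unchanged.
  linear_combination (weakPartial 0 u (rot α x) * weakPartial 0 v (rot α x)
    + weakPartial 1 u (rot α x) * weakPartial 1 v (rot α x)) * Real.sin_sq_add_cos_sq α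

end Rotation

/-! ### Linearity of the scalar product and the `H¹` norm -/

section Linear

theorem IsWeakPartial.sub {i : Fin 2} {u v g h : Plane → ℝ} (hu : MemLp u 2 volume)
    (hv : MemLp v 2 volume) (hg : MemLp g 2 volume) (hh : MemLp h 2 volume)
    (hug : IsWeakPartial i u g) (hvh : IsWeakPartial i v h) :
    IsWeakPartial i (fun x => u x - v x) (fun x => g x - h x) := by
  intro φ hφ hc
  have hcont : Continuous fun x => fderiv ℝ φ x (EuclideanSpace.single i 1) :=
    (hφ.continuous_fderiv (by simp)).clm_apply continuous_const
  simp only [sub_mul]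
  rw [integral_sub (integrable_mul_test hu hcont (hc.fderiv_apply ℝ _))
    (integrable_mul_test hv hcont (hc.fderiv_apply ℝ _)),
    integral_sub (integrable_mul_test hg hφ.continuous hc)
    (integrable_mul_test hh hφ.continuous hc), hug φ hφ hc, hvh φ hφ hc]
  ring

theorem MemH1.sub {u v : Plane → ℝ} (hu : MemH1 u) (hv : MemH1 v) :
    MemH1 fun x => u x - v x :=
  ⟨hu.1.sub hv.1, fun i => ⟨_, (hu.memLp_weakPartial i).sub (hv.memLp_weakPartial i),
    IsWeakPartial.sub hu.1 hv.1 (hu.memLp_weakPartial i) (hv.memLp_weakPartial i)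
      (hu.isWeakPartial i) (hv.isWeakPartial i)⟩⟩

theorem MemH1.weakPartial_sub {u v : Plane → ℝ} (hu : MemH1 u) (hv : MemH1 v) (i : Fin 2) :
    weakPartial i (fun x => u x - v x) =ᵐ[volume]
      fun x => weakPartial i u x - weakPartial i v x :=
  weakPartial_ae_eq ((hu.memLp_weakPartial i).sub (hv.memLp_weakPartial i))
    (IsWeakPartial.sub hu.1 hv.1 (hu.memLp_weakPartial i) (hv.memLp_weakPartial i)
      (hu.isWeakPartial i) (hv.isWeakPartial i))

theorem MemH1.angularDeriv_sub {u v : Plane → ℝ} (hu : MemH1 u) (hv : MemH1 v) :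
    angularDeriv (fun x => u x - v x) =ᵐ[volume]
      fun x => angularDeriv u x - angularDeriv v x := by
  filter_upwards [hu.weakPartial_sub hv 0, hu.weakPartial_sub hv 1] with x h0 h1
  rw [angularDeriv, h0, h1, angularDeriv, angularDeriv]
  ring

theorem MemH.sub {u v : Plane → ℝ} (hu : MemH u) (hv : MemH v) : MemH fun x => u x - v x :=
  ⟨hu.1.sub hv.1, (hu.2.sub hv.2).ae_eq (hu.1.angularDeriv_sub hv.1).symm⟩

theorem MemH.integrable_lambdaInner {u v : Plane → ℝ} (hu : MemH u) (hv : MemH v) (lam : ℝ) :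
    Integrable (fun x => (weakPartial 0 u x * weakPartial 0 v x
      + weakPartial 1 u x * weakPartial 1 v x)
      + 1 / lam ^ 2 * (angularDeriv u x * angularDeriv v x) + u x * v x) volume :=
  (((integrable_mul_of_memLp_two (hu.1.memLp_weakPartial 0) (hv.1.memLp_weakPartial 0)).add
    (integrable_mul_of_memLp_two (hu.1.memLp_weakPartial 1) (hv.1.memLp_weakPartial 1))).add
    ((integrable_mul_of_memLp_two hu.2 hv.2).const_mul _)).add
    (integrable_mul_of_memLp_two hu.1.1 hv.1.1)

theorem lambdaInner_sub_left {u v w : Plane → ℝ} (hu : MemH u) (hv : MemH v) (hw : MemH w)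
    (lam : ℝ) :
    lambdaInner lam (fun x => u x - v x) w = lambdaInner lam u w - lambdaInner lam v w := by
  rw [lambdaInner, lambdaInner, lambdaInner,
    ← integral_sub (hu.integrable_lambdaInner hw lam) (hv.integrable_lambdaInner hw lam)]
  refine integral_congr_ae ?_
  filter_upwards [hu.1.weakPartial_sub hv.1 0, hu.1.weakPartial_sub hv.1 1,
    hu.1.angularDeriv_sub hv.1] with x h0 h1 h2
  rw [h0, h1, h2]
  ring

/-- The square of the `H¹` norm. -/
noncomputable def h1Sq (u : Plane → ℝ) : ℝ :=
  ∫ x, (weakPartial 0 u x ^ 2 + weakPartial 1 u x ^ 2 + u x ^ 2)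

theorem MemH1.h1Sq_eq {u : Plane → ℝ} (hu : MemH1 u) :
    h1Sq u = (∫ x, weakPartial 0 u x ^ 2) + (∫ x, weakPartial 1 u x ^ 2) + ∫ x, u x ^ 2 := by
  have h : Integrable (fun x => weakPartial 0 u x ^ 2 + weakPartial 1 u x ^ 2) volume :=
    (hu.memLp_weakPartial 0).integrable_sq.add (hu.memLp_weakPartial 1).integrable_sq
  rw [h1Sq, integral_add h hu.1.integrable_sq,
    integral_add (hu.memLp_weakPartial 0).integrable_sq (hu.memLp_weakPartial 1).integrable_sq]

theorem h1Sq_nonneg (u : Plane → ℝ) : 0 ≤ h1Sq u :=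
  integral_nonneg fun x => by positivity

theorem MemH.lambdaInner_self {u : Plane → ℝ} (hu : MemH u) (lam : ℝ) :
    lambdaInner lam u u = h1Sq u + 1 / lam ^ 2 * ∫ x, angularDeriv u x ^ 2 := by
  have h : Integrable (fun x => weakPartial 0 u x ^ 2 + weakPartial 1 u x ^ 2 + u x ^ 2) volume :=
    ((hu.1.memLp_weakPartial 0).integrable_sq.add
      (hu.1.memLp_weakPartial 1).integrable_sq).add hu.1.1.integrable_sq
  rw [lambdaInner, h1Sq, ← integral_const_mul, ← integral_add h (hu.2.integrable_sq.const_mul _)]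
  refine integral_congr_ae (Filter.Eventually.of_forall fun x => ?_)
  ring

theorem eLpNorm_two_eq_ofReal {f : Plane → ℝ} (hf : MemLp f 2 volume) :
    eLpNorm f 2 volume = ENNReal.ofReal (Real.sqrt (∫ x, f x ^ 2)) := by
  rw [hf.eLpNorm_eq_integral_rpow_norm (by norm_num) (by norm_num), Real.sqrt_eq_rpow]
  simp

theorem MemH1.h1Norm_le {u : Plane → ℝ} (hu : MemH1 u) :
    h1Norm u ≤ ENNReal.ofReal (3 * Real.sqrt (h1Sq u)) := by
  have h0 : 0 ≤ ∫ x, weakPartial 0 u x ^ 2 := integral_nonneg fun x => by positivity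
  have h1 : 0 ≤ ∫ x, weakPartial 1 u x ^ 2 := integral_nonneg fun x => by positivity
  have h2 : 0 ≤ ∫ x, u x ^ 2 := integral_nonneg fun x => by positivity
  have h := hu.h1Sq_eq
  rw [h1Norm, eLpNorm_two_eq_ofReal hu.1, eLpNorm_two_eq_ofReal (hu.memLp_weakPartial 0),
    eLpNorm_two_eq_ofReal (hu.memLp_weakPartial 1), ← ENNReal.ofReal_add (by positivity)
    (by positivity), ← ENNReal.ofReal_add (by positivity) (by positivity)]
  refine ENNReal.ofReal_le_ofReal ?_
  have a0 := Real.sqrt_le_sqrt (show (∫ x, weakPartial 0 u x ^ 2) ≤ h1Sq u by linarith)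
  have a1 := Real.sqrt_le_sqrt (show (∫ x, weakPartial 1 u x ^ 2) ≤ h1Sq u by linarith)
  have a2 := Real.sqrt_le_sqrt (show (∫ x, u x ^ 2) ≤ h1Sq u by linarith)
  linarith

end Linear

/-! ### Restriction to circles and differentiation in the angle -/

section Circles

open Real

/-- Lebesgue measure on one period `(0, 2π]` of angles. -/
noncomputable def angleMeasure : Measure ℝ := volume.restrict (Set.Ioc 0 (2 * π))

instance : IsFiniteMeasure angleMeasure := by
  unfold angleMeasure; infer_instance

theorem integral_angleMeasure {E : Type*} [NormedAddCommGroup E] [NormedSpace ℝ E] (f : ℝ → E) :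
    ∫ α, f α ∂angleMeasure = ∫ α in (0 : ℝ)..(2 * π), f α := by
  rw [intervalIntegral.integral_of_le two_pi_pos.le, angleMeasure]

theorem integral_angleMeasure_const (c : ℝ) : ∫ _, c ∂angleMeasure = 2 * π * c := by
  rw [integral_angleMeasure]; simp

theorem rot_eq_cos_add_sin (α : ℝ) (x : Plane) :
    rot α x = cos α • x + sin α • rot (π / 2) x := by
  apply plane_ext <;> simp <;> ring

theorem continuous_rot_uncurry : Continuous fun q : ℝ × Plane => rot q.1 q.2 := by
  have := (rot (π / 2)).continuous
  have h : Continuous fun q : ℝ × Plane => cos q.1 • q.2 + sin q.1 • rot (π / 2) q.2 := by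
    fun_prop
  exact h.congr fun q => (rot_eq_cos_add_sin q.1 q.2).symm

theorem hasDerivAt_rot (α : ℝ) (x : Plane) :
    HasDerivAt (fun α => rot α x) (rot (π / 2) (rot α x)) α := by
  have h : HasDerivAt (fun α => cos α • x + sin α • rot (π / 2) x)
      (-sin α • x + cos α • rot (π / 2) x) α :=
    ((hasDerivAt_cos α).smul_const x).add ((hasDerivAt_sin α).smul_const _)
  convert! h using 1
  · ext1 α; exact rot_eq_cos_add_sin α x
  · apply plane_ext <;> simp <;> ring

/-- For each fixed angle the preimage of a null set is null, so Fubini applies. This makes `(α, x) ↦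
f (rot α x)` measurable when `f` is only almost everywhere strongly measurable. -/
theorem quasiMeasurePreserving_rot : Measure.QuasiMeasurePreserving
    (fun q : ℝ × Plane => rot q.1 q.2) (angleMeasure.prod volume) volume := by
  refine ⟨continuous_rot_uncurry.measurable, ?_⟩
  refine Measure.AbsolutelyContinuous.mk fun s hs h0 => ?_
  rw [Measure.map_apply continuous_rot_uncurry.measurable hs,
    Measure.measure_prod_null (continuous_rot_uncurry.measurable hs)]
  refine Filter.Eventually.of_forall fun α => ?_
  exact ((measurePreserving_rot α).measure_preimage hs.nullMeasurableSet).trans h0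

theorem _root_.MeasureTheory.MemLp.integrable_sq_rot {f : Plane → ℝ} (hf : MemLp f 2 volume) :
    Integrable (fun q : ℝ × Plane => f (rot q.1 q.2) ^ 2) (angleMeasure.prod volume) := by
  have hm := (hf.1.comp_quasiMeasurePreserving quasiMeasurePreserving_rot).pow 2
  refine (integrable_prod_iff hm).2 ⟨Filter.Eventually.of_forall fun α =>
    (hf.comp_rot α).integrable_sq, ?_⟩
  have : (fun α : ℝ => ∫ x : Plane, ‖((f ∘ fun q : ℝ × Plane => rot q.1 q.2) ^ 2) (α, x)‖)
      = fun _ => ∫ x, f x ^ 2 := by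
    ext1 α
    rw [← integral_comp_rot (fun x => f x ^ 2) α]
    simp
  rw [this]
  exact integrable_const _

theorem _root_.MeasureTheory.MemLp.memLp_rot {f : Plane → ℝ} (hf : MemLp f 2 volume) :
    MemLp (fun q : ℝ × Plane => f (rot q.1 q.2)) 2 (angleMeasure.prod volume) :=
  (memLp_two_iff_integrable_sq
    (hf.1.comp_quasiMeasurePreserving quasiMeasurePreserving_rot)).2 hf.integrable_sq_rot

theorem integral_integral_sq_rot {f : Plane → ℝ} (hf : MemLp f 2 volume) :
    ∫ x, ∫ α, f (rot α x) ^ 2 ∂angleMeasure = 2 * π * ∫ x, f x ^ 2 := by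
  rw [← integral_integral_swap hf.integrable_sq_rot]
  simp only [fun α => integral_comp_rot (fun x => f x ^ 2) α]
  exact integral_angleMeasure_const _

theorem _root_.MeasureTheory.MemLp.ae_memLp_rot {f : Plane → ℝ} (hf : MemLp f 2 volume) :
    ∀ᵐ x, MemLp (fun α => f (rot α x)) 2 angleMeasure := by
  have hm := hf.1.comp_quasiMeasurePreserving quasiMeasurePreserving_rot
  filter_upwards [hm.prodMk_right, hf.integrable_sq_rot.prod_left_ae] with x h1 h2
  exact (memLp_two_iff_integrable_sq h1).2 h2

theorem integrable_rot_mul_test {f φ : Plane → ℝ} (hf : MemLp f 2 volume) (hφ : Continuous φ)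
    (hc : HasCompactSupport φ) :
    Integrable (fun q : ℝ × Plane => f (rot q.1 q.2) * φ q.2) (angleMeasure.prod volume) := by
  have h2 : MemLp (fun q : ℝ × Plane => φ q.2) 2 (angleMeasure.prod volume) :=
    (memLp_two_iff_integrable_sq (hφ.comp continuous_snd).aestronglyMeasurable).2
      (Integrable.comp_snd (hφ.memLp_of_hasCompactSupport (p := 2) hc).integrable_sq _)
  exact hf.memLp_rot.integrable_mul h2

theorem hasCompactSupport_fderiv_rot {φ : Plane → ℝ} (hc : HasCompactSupport φ) :
    HasCompactSupport fun y => fderiv ℝ φ y (rot (π / 2) y) := by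
  refine (hc.fderiv ℝ).mono' fun y hy => subset_tsupport _ ?_
  rw [Function.mem_support] at hy ⊢
  exact fun h => hy (by simp [h])

theorem continuous_fderiv_rot {φ : Plane → ℝ} (hφ : ContDiff ℝ ∞ φ) :
    Continuous fun y => fderiv ℝ φ y (rot (π / 2) y) :=
  (hφ.continuous_fderiv (by simp)).clm_apply (rot (π / 2)).continuous

/-- Integration by parts for the angular derivative. -/
theorem MemH.integral_mul_fderiv_rot {u : Plane → ℝ} (hu : MemH u) {φ : Plane → ℝ}
    (hφ : ContDiff ℝ ∞ φ) (hc : HasCompactSupport φ) :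
    ∫ x, u x * fderiv ℝ φ x (rot (π / 2) x) = - ∫ x, angularDeriv u x * φ x := by
  have hcoord : ∀ i : Fin 2, ContDiff ℝ ∞ fun x : Plane => x i := fun i =>
    (EuclideanSpace.proj i : Plane →L[ℝ] ℝ).contDiff
  have hψ : ∀ i : Fin 2, ContDiff ℝ ∞ fun x : Plane => x i * φ x := fun i => (hcoord i).mul hφ
  have hψc : ∀ i : Fin 2, HasCompactSupport fun x : Plane => x i * φ x := fun i => hc.mul_left
  have hd : ∀ i x v, fderiv ℝ (fun x : Plane => x i * φ x) x v
      = v i * φ x + x i * fderiv ℝ φ x v := fun i x v => by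
    have h1 : HasFDerivAt (fun x : Plane => x i) (EuclideanSpace.proj i : Plane →L[ℝ] ℝ) x :=
      (EuclideanSpace.proj i : Plane →L[ℝ] ℝ).hasFDerivAt
    have := h1.mul (hφ.differentiable (by simp) x).hasFDerivAt
    change fderiv ℝ ((fun x : Plane => x i) * φ) x v = _
    rw [this.fderiv]
    simp
    ring
  have hint : ∀ i j : Fin 2, Integrable (fun x => u x *
      fderiv ℝ (fun x : Plane => x i * φ x) x (EuclideanSpace.single j 1)) volume := fun i j =>
    integrable_mul_test hu.1.1
      (((hψ i).continuous_fderiv (by simp)).clm_apply continuous_const)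
      ((hψc i).fderiv_apply ℝ _)
  -- The field `rot (π / 2) x = (-x₁, x₀)` is divergence free: each component is independent of the
  -- variable it is paired with, so the coordinates can be absorbed into the test functions without
  -- extra terms.
  have e1 : ∀ x, u x * fderiv ℝ φ x (rot (π / 2) x)
      = u x * fderiv ℝ (fun x : Plane => x 0 * φ x) x (EuclideanSpace.single 1 1)
        - u x * fderiv ℝ (fun x : Plane => x 1 * φ x) x (EuclideanSpace.single 0 1) := fun x => by
    have hv : rot (π / 2) x = x 0 • EuclideanSpace.single 1 1 - x 1 • EuclideanSpace.single 0 1 := by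
      apply plane_ext <;> simp
    rw [hv, hd, hd]
    simp
    ring
  have i0 := integrable_mul_test (hu.1.memLp_weakPartial 1) (hψ 0).continuous (hψc 0)
  have i1 := integrable_mul_test (hu.1.memLp_weakPartial 0) (hψ 1).continuous (hψc 1)
  simp only [e1]
  rw [integral_sub (hint 0 1) (hint 1 0), hu.1.isWeakPartial 1 _ (hψ 0) (hψc 0),
    hu.1.isWeakPartial 0 _ (hψ 1) (hψc 1), sub_neg_eq_add, neg_add_eq_sub, ← neg_sub,
    ← integral_sub i0 i1]
  congr 1
  refine integral_congr_ae (Filter.Eventually.of_forall fun x => ?_)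
  simp only [angularDeriv]
  ring

/-- Since `u` has only weak derivatives, the rotation is first moved onto `φ`, where differentiation
under the integral is legitimate; integration by parts for the rotated `u` then returns the
derivative to `u`. -/
theorem MemH.hasDerivAt_integral_rot_mul {u : Plane → ℝ} (hu : MemH u) {φ : Plane → ℝ}
    (hφ : ContDiff ℝ ∞ φ) (hc : HasCompactSupport φ) (α : ℝ) :
    HasDerivAt (fun α => ∫ x, u (rot α x) * φ x) (∫ x, angularDeriv u (rot α x) * φ x) α := by
  set ζ : Plane → ℝ := fun y => fderiv ℝ φ y (rot (π / 2) y)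
  have hζ : Continuous ζ := continuous_fderiv_rot hφ
  have hζc : HasCompactSupport ζ := hasCompactSupport_fderiv_rot hc
  obtain ⟨M, hM⟩ := hζc.exists_bound_of_continuous hζ
  obtain ⟨R, hR⟩ := hζc.isCompact.isBounded.subset_closedBall 0
  have hM0 : 0 ≤ M := (norm_nonneg _).trans (hM 0)
  have e1 : (fun α => ∫ x, u (rot α x) * φ x) = fun α => ∫ x, u x * φ (rot (-α) x) := by
    ext1 α
    rw [← integral_comp_rot (fun x => u x * φ (rot (-α) x)) α]
    simp only [rot_neg_rot]
  have e2 : ∫ x, angularDeriv u (rot α x) * φ x = ∫ x, u x * -ζ (rot (-α) x) := by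
    have h := (hu.comp_rot α).integral_mul_fderiv_rot hφ hc
    rw [← integral_comp_rot (fun x => u x * -ζ (rot (-α) x)) α]
    simp only [rot_neg_rot, mul_neg, integral_neg]
    rw [h, neg_neg]
    refine integral_congr_ae ?_
    filter_upwards [hu.1.angularDeriv_comp_rot α] with x hx
    rw [hx]
  rw [e1, e2]
  have hul : LocallyIntegrable u volume := hu.1.1.locallyIntegrable (by norm_num)
  -- Rotations preserve the norm, so one ball containing the support of `ζ` gives a dominating
  -- function valid for all angles.
  let bd : Plane → ℝ := (Metric.closedBall (0 : Plane) R).indicator fun x => ‖u x‖ * M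
  have hbd : Integrable bd volume := by
    refine IntegrableOn.integrable_indicator ?_ measurableSet_closedBall
    exact (hul.integrableOn_isCompact (isCompact_closedBall 0 R)).norm.mul_const M
  have hm : ∀ ψ : Plane → ℝ, Continuous ψ → ∀ β : ℝ,
      AEStronglyMeasurable (fun x => u x * ψ (rot β x)) volume := fun ψ hψ β =>
    hu.1.1.1.mul (hψ.comp (rot β).continuous).aestronglyMeasurable
  refine (hasDerivAt_integral_of_dominated_loc_of_deriv_le (bound := bd)
    (F := fun α x => u x * φ (rot (-α) x)) (F' := fun α x => u x * -ζ (rot (-α) x))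
    (x₀ := α) Filter.univ_mem
    (Filter.Eventually.of_forall fun β => hm φ hφ.continuous (-β)) ?_
    (hm (fun x => -ζ x) hζ.neg (-α)) ?_ hbd ?_).2
  · exact integrable_mul_test hu.1.1 (hφ.continuous.comp (rot (-α)).continuous)
      (hc.comp_homeomorph (rot (-α)).toHomeomorph)
  · refine Filter.Eventually.of_forall fun x β _ => ?_
    by_cases hx : x ∈ Metric.closedBall (0 : Plane) R
    · rw [norm_mul, norm_neg]
      simp only [bd, Set.indicator_of_mem hx]
      gcongr
      exact hM _
    · have h0 : ζ (rot (-β) x) = 0 := by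
        by_contra hne
        refine hx ?_
        have := hR (subset_tsupport _ hne)
        rwa [mem_closedBall_zero_iff, LinearIsometryEquiv.norm_map,
          ← mem_closedBall_zero_iff] at this
      rw [h0]
      simp [bd, hx]
  · refine Filter.Eventually.of_forall fun x β _ => ?_
    have h1 : HasDerivAt (fun β => rot (-β) x) (-rot (π / 2) (rot (-β) x)) β := by
      have := (hasDerivAt_rot (-β) x).scomp β (hasDerivAt_neg β)
      simpa [Function.comp_def] using this
    have h2 := ((hφ.differentiable (by simp) (rot (-β) x)).hasFDerivAt).comp_hasDerivAt β h1
    rw [map_neg] at h2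
    exact h2.const_mul (u x)

end Circles

/-! ### Fourier series on circles, Wirtinger's inequality and radiality -/

section Wirtinger

open Real

/-- The `n`-th angular Fourier coefficient of `f` on the circle through `x`. -/
noncomputable def angularCoeff (f : Plane → ℝ) (n : ℤ) (x : Plane) : ℂ :=
  fourierCoeffOn two_pi_pos (fun α => (f (rot α x) : ℂ)) n

theorem fourierCoeffOn_two_pi_eq (a : ℝ → ℂ) (n : ℤ) :
    fourierCoeffOn two_pi_pos a n = (1 / (2 * π)) •
      ∫ α, fourier (-n) (α : AddCircle (2 * π - 0)) * a α ∂angleMeasure := by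
  rw [fourierCoeffOn_eq_integral, integral_angleMeasure]
  simp [sub_zero]

theorem continuous_fourier_coe (n : ℤ) :
    Continuous fun α : ℝ => (fourier n (α : AddCircle (2 * π - 0)) : ℂ) :=
  (fourier n).continuous.comp (AddCircle.continuous_mk' _)

theorem integrable_fourier_mul {X : Type*} [MeasurableSpace X] {μ : Measure X} [SFinite μ]
    {F : ℝ × X → ℝ} (hF : Integrable F (angleMeasure.prod μ)) (n : ℤ) :
    Integrable (fun q : ℝ × X => fourier n (q.1 : AddCircle (2 * π - 0)) * (F q : ℂ))
      (angleMeasure.prod μ) := by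
  refine hF.ofReal.bdd_mul (c := 1) ?_ ?_
  · exact ((continuous_fourier_coe n).measurable.comp measurable_fst).aestronglyMeasurable
  · exact Filter.Eventually.of_forall fun q => le_of_eq (by rw [fourier_apply, Circle.norm_coe])

theorem locallyIntegrable_angularCoeff {f : Plane → ℝ} (hf : MemLp f 2 volume) (n : ℤ) :
    LocallyIntegrable (angularCoeff f n) volume := by
  rw [locallyIntegrable_iff]
  intro K hK
  have : IsFiniteMeasure (volume.restrict K) := ⟨by
    rw [Measure.restrict_apply_univ]; exact hK.measure_lt_top⟩
  have h1 : MemLp (fun q : ℝ × Plane => f (rot q.1 q.2)) 2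
      (angleMeasure.prod (volume.restrict K)) := by
    have := hf.memLp_rot.restrict (Set.univ ×ˢ K)
    rwa [← Measure.prod_restrict, Measure.restrict_univ] at this
  have h2 := (integrable_fourier_mul (h1.integrable (by norm_num)) (-n)).integral_prod_right
  have h3 := h2.smul (1 / (2 * π))
  refine h3.congr (Filter.Eventually.of_forall fun x => ?_)
  simp only [angularCoeff, fourierCoeffOn_two_pi_eq, Pi.smul_apply]

/-- Fubini: testing in `x` commutes with taking Fourier coefficients in `α`, which replaces the
rough function on each circle by a differentiable function of `α`. -/
theorem integral_smul_angularCoeff {f φ : Plane → ℝ} (hf : MemLp f 2 volume) (n : ℤ)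
    (hφ : Continuous φ) (hc : HasCompactSupport φ) :
    ∫ x, φ x • angularCoeff f n x
      = fourierCoeffOn two_pi_pos (fun α => ((∫ x, f (rot α x) * φ x : ℝ) : ℂ)) n := by
  have hint := integrable_fourier_mul (integrable_rot_mul_test hf hφ hc) (-n)
  have e1 : ∀ x, φ x • angularCoeff f n x = (1 / (2 * π)) •
      ∫ α, fourier (-n) (α : AddCircle (2 * π - 0)) * ((f (rot α x) * φ x : ℝ) : ℂ)
        ∂angleMeasure := fun x => by
    rw [angularCoeff, fourierCoeffOn_two_pi_eq, smul_comm, ← integral_smul]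
    congr 1
    refine integral_congr_ae (Filter.Eventually.of_forall fun α => ?_)
    simp only [Complex.real_smul, Complex.ofReal_mul]
    ring
  simp only [e1]
  rw [integral_smul, ← integral_integral_swap hint, fourierCoeffOn_two_pi_eq]
  congr 1
  refine integral_congr_ae (Filter.Eventually.of_forall fun α => ?_)
  simp only
  rw [integral_const_mul, integral_complex_ofReal]

/-- The identity is checked against every test function in `x`. There it is the usual rule for the
Fourier coefficients of a derivative, whose boundary term vanishes by periodicity. -/
theorem MemH.ae_angularCoeff_eq {u : Plane → ℝ} (hu : MemH u) {n : ℤ} (hn : n ≠ 0) :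
    ∀ᵐ x, angularCoeff u n x = 1 / (Complex.I * n) * angularCoeff (angularDeriv u) n x := by
  set κ : ℂ := 1 / (Complex.I * n)
  have l1 := locallyIntegrable_angularCoeff hu.1.1 n
  have l2 := locallyIntegrable_angularCoeff hu.2 n
  have l3 : LocallyIntegrable (fun x => κ • angularCoeff (angularDeriv u) n x) volume := l2.smul κ
  have key : ∀ᵐ x, angularCoeff u n x - κ • angularCoeff (angularDeriv u) n x = 0 := by
    refine ae_eq_zero_of_integral_contDiff_smul_eq_zero (l1.sub l3) fun φ hφ hc => ?_
    have i1 := l1.integrable_smul_left_of_hasCompactSupport hφ.continuous hc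
    have i2 := l2.integrable_smul_left_of_hasCompactSupport hφ.continuous hc
    have e : ∀ x, φ x • (angularCoeff u n x - κ • angularCoeff (angularDeriv u) n x)
        = φ x • angularCoeff u n x - κ • (φ x • angularCoeff (angularDeriv u) n x) := fun x => by
      rw [smul_sub, smul_comm]
    refine (integral_congr_ae (Filter.Eventually.of_forall e)).trans ?_
    have i3 : Integrable (fun x => κ • φ x • angularCoeff (angularDeriv u) n x) volume := i2.smul κ
    rw [integral_sub i1 i3, integral_smul,
      integral_smul_angularCoeff hu.1.1 n hφ.continuous hc,
      integral_smul_angularCoeff hu.2 n hφ.continuous hc]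
    have hb : IntervalIntegrable
        (fun α => ((∫ x, angularDeriv u (rot α x) * φ x : ℝ) : ℂ)) volume 0 (2 * π) := by
      rw [intervalIntegrable_iff_integrableOn_Ioc_of_le two_pi_pos.le]
      exact ((integrable_rot_mul_test hu.2 hφ.continuous hc).integral_prod_left).ofReal
    rw [fourierCoeffOn_of_hasDerivAt two_pi_pos hn
      (fun α _ => (hu.hasDerivAt_integral_rot_mul hφ hc α).ofReal_comp) hb]
    have hper : ∀ x : Plane, rot (2 * π) x = x := fun x => by
      simpa using rot_periodic x 0
    have hnC : (n : ℂ) ≠ 0 := by exact_mod_cast hn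
    have hπ : (π : ℂ) ≠ 0 := by exact_mod_cast pi_ne_zero
    simp only [hper, rot_zero, sub_self, mul_zero, κ, smul_eq_mul]
    push_cast
    field_simp
    ring
  filter_upwards [key] with x hx
  rw [sub_eq_zero] at hx
  exact hx

/-- **Wirtinger's inequality** on circles about the origin. -/
theorem MemH.integral_sq_le_integral_sq_angularDeriv {u : Plane → ℝ} (hu : MemH u)
    (hmean : ∀ᵐ x, ∫ α, u (rot α x) ∂angleMeasure = 0) :
    ∫ x, u x ^ 2 ≤ ∫ x, angularDeriv u x ^ 2 := by
  have hcoef : ∀ᵐ x, ∀ n : ℤ, ‖angularCoeff u n x‖ ≤ ‖angularCoeff (angularDeriv u) n x‖ := by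
    rw [ae_all_iff]
    intro n
    rcases eq_or_ne n 0 with rfl | hn
    · filter_upwards [hmean] with x hx
      have : angularCoeff u 0 x = 0 := by
        rw [angularCoeff, fourierCoeffOn_two_pi_eq]
        simp only [neg_zero, fourier_zero, one_mul]
        rw [integral_complex_ofReal, hx]
        simp
      rw [this, norm_zero]
      exact norm_nonneg _
    · filter_upwards [hu.ae_angularCoeff_eq hn] with x hx
      rw [hx, norm_mul]
      refine mul_le_of_le_one_left (norm_nonneg _) ?_
      have h1 : (1 : ℝ) ≤ |(n : ℝ)| := by exact_mod_cast Int.one_le_abs hn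
      rw [norm_div, norm_one, norm_mul, Complex.norm_I, one_mul, Complex.norm_intCast]
      exact div_le_one_of_le₀ h1 (abs_nonneg _)
  -- Parseval on the circle through `x`; with the coefficientwise comparison it gives the inequality
  -- on almost every circle, and integrating over `x` finishes.
  have hpars : ∀ f : Plane → ℝ, ∀ x, MemLp (fun α => f (rot α x)) 2 angleMeasure →
      HasSum (fun n : ℤ => ‖angularCoeff f n x‖ ^ 2)
        ((2 * π)⁻¹ * ∫ α, f (rot α x) ^ 2 ∂angleMeasure) := fun f x hf => by
    have := hasSum_sq_fourierCoeffOn two_pi_pos (f := fun α => (f (rot α x) : ℂ)) hf.ofReal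
    rw [← integral_angleMeasure] at this
    simpa [angularCoeff] using this
  have hle : ∀ᵐ x, ∫ α, u (rot α x) ^ 2 ∂angleMeasure
      ≤ ∫ α, angularDeriv u (rot α x) ^ 2 ∂angleMeasure := by
    filter_upwards [hcoef, hu.1.1.ae_memLp_rot, hu.2.ae_memLp_rot] with x h1 h2 h3
    have := hasSum_le (fun n => pow_le_pow_left₀ (norm_nonneg _) (h1 n) 2) (hpars u x h2)
      (hpars _ x h3)
    exact le_of_mul_le_mul_left this (by positivity)
  have := integral_mono_ae hu.1.1.integrable_sq_rot.integral_prod_right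
    hu.2.integrable_sq_rot.integral_prod_right hle
  simp only [integral_integral_sq_rot hu.1.1, integral_integral_sq_rot hu.2] at this
  exact le_of_mul_le_mul_left this two_pi_pos

theorem integral_rot_rot (u : Plane → ℝ) (β : ℝ) (x : Plane) :
    ∫ α, u (rot α (rot β x)) ∂angleMeasure = ∫ α, u (rot α x) ∂angleMeasure := by
  have hp : Function.Periodic (fun α => u (rot α x)) (2 * π) := (rot_periodic x).comp u
  rw [integral_angleMeasure, integral_angleMeasure]
  simp only [rot_rot]
  rw [intervalIntegral.integral_comp_add_right (fun α => u (rot α x)) β]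
  have := hp.intervalIntegral_add_eq β 0
  rw [zero_add, add_comm β] at this
  rwa [zero_add]

/-- Wirtinger's inequality for the difference of `u` and a rotation of `u`. -/
theorem MemH.integral_sq_rot_sub_le {u : Plane → ℝ} (hu : MemH u) (β : ℝ) :
    ∫ x, (u (rot β x) - u x) ^ 2
      ≤ ∫ x, angularDeriv (fun x => u (rot β x) - u x) x ^ 2 := by
  refine ((hu.comp_rot β).sub hu).integral_sq_le_integral_sq_angularDeriv ?_
  filter_upwards [hu.1.1.ae_memLp_rot, (hu.comp_rot β).1.1.ae_memLp_rot] with x h1 h2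
  rw [integral_sub (h2.integrable (by norm_num)) (h1.integrable (by norm_num)), sub_eq_zero,
    ← integral_rot_rot u β x]
  simp only [rot_rot, add_comm]

/-- A function invariant under all rotations, up to null sets, is radial. -/
theorem isRadial_of_forall_rot {u : Plane → ℝ} (hu : MemLp u 2 volume)
    (h : ∀ β, ∀ᵐ x, u (rot β x) = u x) : IsRadial u := by
  -- The radial profile is the mean of `u` over the circle of radius `r`.
  refine ⟨fun r => (2 * π)⁻¹ * ∫ α, u (rot α (!₂[r, 0] : Plane)) ∂angleMeasure, ?_⟩
  have hm : AEStronglyMeasurable (fun q : ℝ × Plane => u (rot q.1 q.2) - u q.2)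
      (angleMeasure.prod volume) :=
    (hu.1.comp_quasiMeasurePreserving quasiMeasurePreserving_rot).sub
      (hu.1.comp_quasiMeasurePreserving Measure.quasiMeasurePreserving_snd)
  have h0 : (fun q : ℝ × Plane => u (rot q.1 q.2) - u q.2) =ᵐ[angleMeasure.prod volume] 0 := by
    -- Passing to a strongly measurable representative makes the zero set measurable, as Fubini
    -- needs. The order of quantifiers is then exchanged: for almost every `x`, `u (rot α x) = u x`
    -- for almost every `α`.
    obtain ⟨g, hg, hge⟩ := hm
    have h1 : ∀ᵐ q ∂(angleMeasure.prod (volume : Measure Plane)), g q = 0 := by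
      refine (Measure.ae_prod_iff_ae_ae (p := fun q => g q = 0)
        (hg.measurable (measurableSet_singleton 0))).2 ?_
      filter_upwards [Measure.ae_ae_of_ae_prod hge] with α hα
      filter_upwards [hα, h α] with x hx hx'
      rw [← hx, hx', sub_self]
    filter_upwards [hge, h1] with q h2 h3
    rw [h2, h3]; rfl
  have h1 := Measure.ae_ae_of_ae_prod ((Measure.measurePreserving_swap (μ := (volume : Measure Plane))
    (ν := angleMeasure)).quasiMeasurePreserving.ae h0)
  filter_upwards [h1] with x hx
  obtain ⟨β, hβ⟩ := exists_rot_eq x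
  have h2 : ∫ α, u (rot α x) ∂angleMeasure = 2 * π * u x := by
    rw [← integral_angleMeasure_const]
    refine integral_congr_ae ?_
    filter_upwards [hx] with α hα
    exact sub_eq_zero.1 hα
  have h3 : ∫ α, u (rot α (!₂[‖x‖, 0] : Plane)) ∂angleMeasure = ∫ α, u (rot α x) ∂angleMeasure := by
    rw [← integral_rot_rot u β, ← hβ]
  rw [h3, h2]
  field_simp

end Wirtinger

/-! ### Bounds for the nonlinearity -/

section Nonlinearity

/-- Below `K` the first term suffices; above `K` the factor `t ^ (q - n)` has nonpositive exponent
and is at most its value at `K`. -/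
theorem rpow_le_add_rpow_mul_pow {t K q : ℝ} {n : ℕ} (ht : 0 ≤ t) (hK : 0 < K) (hq : 0 < q)
    (hn : q ≤ n) : t ^ q ≤ K ^ q + K ^ (q - n) * t ^ n := by
  rcases le_total t K with h | h
  · exact (Real.rpow_le_rpow ht h hq.le).trans (le_add_of_nonneg_right (by positivity))
  · have ht0 : 0 < t := hK.trans_le h
    have h1 : t ^ q = t ^ (q - n) * t ^ n := by
      rw [← Real.rpow_natCast t n, ← Real.rpow_add ht0]; congr 1; ring
    have h2 : t ^ (q - n) ≤ K ^ (q - n) := Real.rpow_le_rpow_of_nonpos hK h (by linarith)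
    rw [h1]
    exact (mul_le_mul_of_nonneg_right h2 (by positivity)).trans
      (le_add_of_nonneg_left (by positivity))

theorem hasDerivAt_abs_rpow_mul {q : ℝ} (hq : 0 < q) (t : ℝ) :
    HasDerivAt (fun t : ℝ => |t| ^ q * t) ((q + 1) * |t| ^ q) t := by
  rcases lt_trichotomy t 0 with ht | rfl | ht
  · have h1 : HasDerivAt (fun t : ℝ => -(-t) ^ (q + 1)) ((q + 1) * (-t) ^ q) t := by
      have := ((hasDerivAt_neg t).rpow_const (p := q + 1) (Or.inl (by linarith))).neg
      convert! this using 1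
      ring_nf
    rw [abs_of_neg ht]
    refine h1.congr_of_eventuallyEq ?_
    filter_upwards [gt_mem_nhds ht] with s hs
    rw [abs_of_neg hs, Real.rpow_add_one (by linarith)]
    ring
  -- At `0` the difference quotient is `|s| ^ q` itself, so continuity of that function gives the
  -- derivative.
  · have hc : Continuous fun t : ℝ => |t| ^ q := continuous_abs.rpow_const fun _ => Or.inr hq.le
    rw [hasDerivAt_iff_tendsto_slope]
    have h0 : (q + 1) * |(0 : ℝ)| ^ q = |(0 : ℝ)| ^ q := by
      simp [Real.zero_rpow hq.ne']
    rw [h0]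
    refine ((hc.tendsto 0).mono_left nhdsWithin_le_nhds).congr' ?_
    filter_upwards [self_mem_nhdsWithin] with s hs
    have hs' : s ≠ 0 := hs
    rw [slope_def_field]
    field_simp
    simp
  · have h1 : HasDerivAt (fun t : ℝ => t ^ (q + 1)) ((q + 1) * t ^ q) t := by
      have := Real.hasDerivAt_rpow_const (x := t) (p := q + 1) (Or.inl ht.ne')
      rwa [add_sub_cancel_right] at this
    rw [abs_of_pos ht]
    refine h1.congr_of_eventuallyEq ?_
    filter_upwards [lt_mem_nhds ht] with s hs
    rw [abs_of_pos hs, Real.rpow_add_one hs.ne']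

/-- A local Lipschitz bound for the nonlinearity `t ↦ |t|^q t`. -/
theorem abs_rpow_mul_sub_mul_le {q a b m : ℝ} (hq : 0 < q) (ha : |a| ≤ m) (hb : |b| ≤ m) :
    (|a| ^ q * a - |b| ^ q * b) * (a - b) ≤ (q + 1) * m ^ q * (a - b) ^ 2 := by
  have h := (convex_Icc (-m) m).norm_image_sub_le_of_norm_hasDerivWithin_le
    (f := fun t : ℝ => |t| ^ q * t) (f' := fun t => (q + 1) * |t| ^ q) (C := (q + 1) * m ^ q)
    (fun t _ => (hasDerivAt_abs_rpow_mul hq t).hasDerivWithinAt)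
    (fun t ht => by
      rw [Real.norm_of_nonneg (by positivity)]
      gcongr
      exact abs_le.2 ht) (abs_le.1 hb) (abs_le.1 ha)
  simp only [Real.norm_eq_abs] at h
  calc _ ≤ |(|a| ^ q * a - |b| ^ q * b) * (a - b)| := le_abs_self _
    _ = |(|a| ^ q * a - |b| ^ q * b)| * |a - b| := abs_mul _ _
    _ ≤ (q + 1) * m ^ q * |a - b| * |a - b| := mul_le_mul_of_nonneg_right h (abs_nonneg _)
    _ = (q + 1) * m ^ q * (a - b) ^ 2 := by rw [mul_assoc, abs_mul_abs_self, sq]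

theorem MemH1.memLp_pow {u : Plane → ℝ} (hu : MemH1 u) (k : ℕ) :
    MemLp (fun x => u x ^ (k + 1)) 2 volume := by
  obtain ⟨C, hC⟩ := exists_eLpNorm_pow_le_h1Norm k
  refine ⟨hu.1.1.pow _, (hC u hu).trans_lt ?_⟩
  exact ENNReal.mul_lt_top (by simp)
    (ENNReal.pow_lt_top (hu.h1Norm_le.trans_lt ENNReal.ofReal_lt_top))

/-- The splitting at level `K = 1` dominates the nonlinearity by `|u| + |u| ^ (⌈q⌉₊ + 1)`. Its
pairing with any `L²` function is thus integrable, as subtracting two equations requires. -/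
theorem MemH1.memLp_nonlinearity {u : Plane → ℝ} (hu : MemH1 u) {q : ℝ} (hq : 0 < q) :
    MemLp (fun x => |u x| ^ q * u x) 2 volume := by
  have hcont : Continuous fun t : ℝ => |t| ^ q * t :=
    (continuous_abs.rpow_const fun _ => Or.inr hq.le).mul continuous_id
  refine MemLp.mono (hu.1.norm.add (hu.memLp_pow ⌈q⌉₊).norm)
    (hcont.comp_aestronglyMeasurable hu.1.1) (Filter.Eventually.of_forall fun x => ?_)
  have h := rpow_le_add_rpow_mul_pow (abs_nonneg (u x)) one_pos hq (Nat.le_ceil q)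
  simp only [Real.one_rpow, one_mul] at h
  change ‖|u x| ^ q * u x‖ ≤ ‖‖u x‖ + ‖u x ^ (⌈q⌉₊ + 1)‖‖
  rw [norm_mul, norm_pow, Real.norm_of_nonneg (by positivity : 0 ≤ |u x| ^ q),
    Real.norm_of_nonneg (by positivity : 0 ≤ ‖u x‖ + ‖u x‖ ^ (⌈q⌉₊ + 1)), Real.norm_eq_abs]
  calc |u x| ^ q * |u x| ≤ (1 + |u x| ^ ⌈q⌉₊) * |u x| := by gcongr
    _ = |u x| + |u x| ^ (⌈q⌉₊ + 1) := by ring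

/-- Cauchy–Schwarz puts `|u| ^ (k + 1)` and `w ^ 2` in `L²`, and the Sobolev embedding bounds each.
The powers of `3` come from `MemH1.h1Norm_le`. -/
theorem integral_abs_pow_mul_sq_le (k : ℕ) : ∃ A : ℝ, 0 ≤ A ∧ ∀ u w : Plane → ℝ,
    MemH1 u → MemH1 w → Integrable (fun x => |u x| ^ (k + 1) * w x ^ 2) volume ∧
      ∫ x, |u x| ^ (k + 1) * w x ^ 2 ≤ A * Real.sqrt (h1Sq u) ^ (k + 1) * h1Sq w := by
  obtain ⟨C, hC⟩ := exists_eLpNorm_pow_le_h1Norm k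
  obtain ⟨D, hD⟩ := exists_eLpNorm_pow_le_h1Norm 1
  refine ⟨C * D * 3 ^ (k + 1) * 3 ^ 2, by positivity, fun u w hu hw => ?_⟩
  have hu1 : MemLp (fun x => |u x| ^ (k + 1)) 2 volume := by
    simpa only [Real.norm_eq_abs, abs_pow] using (hu.memLp_pow k).norm
  have hint := integrable_mul_of_memLp_two hu1 (hw.memLp_pow 1)
  refine ⟨hint, ?_⟩
  have h1 : eLpNorm ((fun x => u x ^ (k + 1)) • fun x => w x ^ 2) 1 volume
      ≤ ENNReal.ofReal (C * D * 3 ^ (k + 1) * 3 ^ 2 * Real.sqrt (h1Sq u) ^ (k + 1) * h1Sq w) := by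
    refine (eLpNorm_smul_le_mul_eLpNorm (p := 2) (q := 2) (hw.memLp_pow 1).1
      (hu.memLp_pow k).1).trans ?_
    calc _ ≤ (C * ENNReal.ofReal (3 * Real.sqrt (h1Sq u)) ^ (k + 1))
          * (D * ENNReal.ofReal (3 * Real.sqrt (h1Sq w)) ^ 2) := by
          refine mul_le_mul' ((hC u hu).trans ?_) ((hD w hw).trans ?_)
          · gcongr; exact hu.h1Norm_le
          · gcongr; exact hw.h1Norm_le
      _ = _ := by
          rw [← ENNReal.ofReal_coe_nnreal, ← ENNReal.ofReal_coe_nnreal,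
            ← ENNReal.ofReal_pow (by positivity), ← ENNReal.ofReal_pow (by positivity),
            ← ENNReal.ofReal_mul (by positivity), ← ENNReal.ofReal_mul (by positivity),
            ← ENNReal.ofReal_mul (by positivity)]
          congr 1
          rw [mul_pow, mul_pow, Real.sq_sqrt (h1Sq_nonneg w)]
          ring
  have h2 : ∫ x, |u x| ^ (k + 1) * w x ^ 2
      = (eLpNorm ((fun x => u x ^ (k + 1)) • fun x => w x ^ 2) 1 volume).toReal := by
    rw [eLpNorm_one_eq_lintegral_enorm, ← integral_norm_eq_lintegral_enorm
      ((hu.memLp_pow k).1.smul (hw.memLp_pow 1).1)]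
    refine integral_congr_ae (Filter.Eventually.of_forall fun x => ?_)
    simp
  rw [h2]
  exact ENNReal.toReal_le_of_le_ofReal (mul_nonneg (by positivity) (h1Sq_nonneg w)) h1

end Nonlinearity

/-! ### Comparing a solution with its rotations -/

section Solutions

theorem IsWeakSolution.comp_rot {p lam : ℝ} {u : Plane → ℝ} (hu : IsWeakSolution p lam u)
    (α : ℝ) : IsWeakSolution p lam fun x => u (rot α x) := by
  refine ⟨hu.1.comp_rot α, fun v hv => ?_⟩
  have h := lambdaInner_comp_rot hu.1.1 (hv.comp_rot (-α)).1 lam α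
  simp only [rot_neg_rot] at h
  rw [h, hu.2 _ (hv.comp_rot (-α)),
    ← integral_comp_rot (fun x => |u x| ^ (p - 2) * u x * v (rot (-α) x)) α]
  simp only [rot_neg_rot]

/-- The equation for the difference of two solutions, tested with that difference. -/
theorem IsWeakSolution.lambdaInner_sub_self {p lam : ℝ} (hp : 2 < p) {u v : Plane → ℝ}
    (hu : IsWeakSolution p lam u) (hv : IsWeakSolution p lam v) :
    Integrable (fun x => (|u x| ^ (p - 2) * u x - |v x| ^ (p - 2) * v x) * (u x - v x)) volume ∧
    lambdaInner lam (fun x => u x - v x) (fun x => u x - v x)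
      = ∫ x, (|u x| ^ (p - 2) * u x - |v x| ^ (p - 2) * v x) * (u x - v x) := by
  have hw := hu.1.sub hv.1
  have hq : 0 < p - 2 := by linarith
  have i1 := integrable_mul_of_memLp_two (hu.1.1.memLp_nonlinearity hq) hw.1.1
  have i2 := integrable_mul_of_memLp_two (hv.1.1.memLp_nonlinearity hq) hw.1.1
  simp only [sub_mul (_ * _)]
  refine ⟨i1.sub i2, ?_⟩
  rw [lambdaInner_sub_left hu.1 hv.1 hw, hu.2 _ hw, hv.2 _ hw, integral_sub i1 i2]

/-- Testing the equation with `u` gives `∫ |u|^p = ⟨u, u⟩_λ`, so the energy equals `(1/2 - 1/p) ⟨u,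
u⟩_λ`, and the factor is positive because `p > 2`. -/
theorem lambdaInner_self_le_of_energy_le {p lam c : ℝ} (hp : 2 < p) {u : Plane → ℝ}
    (hu : IsWeakSolution p lam u) (hc : energy p lam u ≤ c) :
    lambdaInner lam u u ≤ c / (1 / 2 - 1 / p) := by
  have h1 : ∫ x, |u x| ^ (p - 2) * u x * u x = ∫ x, |u x| ^ p := by
    refine integral_congr_ae (Filter.Eventually.of_forall fun x => ?_)
    simp only
    rcases eq_or_ne (u x) 0 with h | h
    · rw [h]; simp [Real.zero_rpow (by linarith : p ≠ 0)]
    · rw [mul_assoc, ← abs_mul_abs_self (u x), ← sq, ← Real.rpow_natCast,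
        ← Real.rpow_add (abs_pos.2 h)]
      congr 1; push_cast; ring
  have h2 := hu.2 u hu.1
  rw [energy, ← h1, ← h2] at hc
  have h3 : 1 / p < 1 / 2 := one_div_lt_one_div_of_lt (by norm_num) hp
  rw [le_div_iff₀ (by linarith)]
  linarith

theorem MemH.h1Sq_le_lambdaInner {u : Plane → ℝ} (hu : MemH u) (lam : ℝ) :
    h1Sq u ≤ lambdaInner lam u u := by
  rw [hu.lambdaInner_self]
  have : 0 ≤ ∫ x, angularDeriv u x ^ 2 := integral_nonneg fun x => by positivity
  have : 0 ≤ 1 / lam ^ 2 * ∫ x, angularDeriv u x ^ 2 := by positivity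
  linarith

theorem MemH1.integral_sq_le_h1Sq {u : Plane → ℝ} (hu : MemH1 u) : ∫ x, u x ^ 2 ≤ h1Sq u := by
  rw [hu.h1Sq_eq]
  have h0 : 0 ≤ ∫ x, weakPartial 0 u x ^ 2 := integral_nonneg fun x => by positivity
  have h1 : 0 ≤ ∫ x, weakPartial 1 u x ^ 2 := integral_nonneg fun x => by positivity
  linarith

/-- A solution is radial as soon as the energy of its difference with a rotated copy is
controlled by a sufficiently small multiple of the `L²` norm and of the `H¹` norm. -/
theorem IsWeakSolution.isRadial_of_forall_lambdaInner_le {p lam Q θ : ℝ} {u : Plane → ℝ}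
    (hu : IsWeakSolution p lam u) (hQ : Q ≤ 1 / lam ^ 2) (hθ : θ < 1)
    (h : ∀ β, lambdaInner lam (fun x => u (rot β x) - u x) (fun x => u (rot β x) - u x)
      ≤ Q * (∫ x, (u (rot β x) - u x) ^ 2) + θ * h1Sq fun x => u (rot β x) - u x) :
    IsRadial u := by
  refine isRadial_of_forall_rot hu.1.1.1 fun β => ?_
  have hw := (hu.1.comp_rot β).sub hu.1
  have hW := hu.1.integral_sq_rot_sub_le β
  have h1 := h β
  rw [hw.lambdaInner_self] at h1
  have h2 := hw.1.integral_sq_le_h1Sq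
  have h0 : 0 ≤ ∫ x, (u (rot β x) - u x) ^ 2 := integral_nonneg fun x => by positivity
  -- Wirtinger's inequality lets the angular part of the scalar product absorb the whole `L²` term.
  have h3 : Q * ∫ x, (u (rot β x) - u x) ^ 2 ≤
      1 / lam ^ 2 * ∫ x, angularDeriv (fun x => u (rot β x) - u x) x ^ 2 :=
    (mul_le_mul_of_nonneg_right hQ h0).trans (mul_le_mul_of_nonneg_left hW (by positivity))
  have h4 : (1 - θ) * h1Sq (fun x => u (rot β x) - u x) ≤ 0 := by linarith
  have h5 : h1Sq (fun x => u (rot β x) - u x) ≤ 0 := by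
    by_contra hne
    exact absurd h4 (not_le.2 (mul_pos (by linarith) (not_le.1 hne)))
  have h6 : ∫ x, (u (rot β x) - u x) ^ 2 = 0 := le_antisymm (h2.trans h5) h0
  rw [integral_eq_zero_iff_of_nonneg (fun x => by positivity) hw.1.1.integrable_sq] at h6
  filter_upwards [h6] with x hx
  exact sub_eq_zero.1 (pow_eq_zero_iff two_ne_zero |>.1 hx)

theorem IsWeakSolution.isRadial_of_ae_abs_le {p lam M : ℝ} (hp : 2 < p)
    {u : Plane → ℝ} (hu : IsWeakSolution p lam u) (hM : ∀ᵐ x, |u x| ≤ M)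
    (hlam : (p - 1) * M ^ (p - 2) ≤ 1 / lam ^ 2) : IsRadial u := by
  refine hu.isRadial_of_forall_lambdaInner_le hlam (θ := 0) one_pos fun β => ?_
  obtain ⟨hi, he⟩ := IsWeakSolution.lambdaInner_sub_self hp (hu.comp_rot β) hu
  have hw := (hu.1.comp_rot β).sub hu.1
  rw [he, zero_mul, add_zero, ← integral_const_mul]
  refine integral_mono_ae hi (hw.1.1.integrable_sq.const_mul _) ?_
  filter_upwards [hM, ae_comp_rot hM β] with x h1 h2
  have := abs_rpow_mul_sub_mul_le (q := p - 2) (by linarith) h2 h1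
  rwa [show p - 2 + 1 = p - 1 by ring] at this

/-- The bound `B` controls the `H¹` norm of `u` and of its rotations independently of `λ`. Hence the
level `K`, and with it `Q`, can be fixed before `λ` is made small. -/
theorem exists_isRadial_of_h1Sq_le {p : ℝ} (hp : 2 < p) (B : ℝ) : ∃ lamc : ℝ, 0 < lamc ∧
    ∀ lam : ℝ, 0 < lam → lam < lamc → ∀ u : Plane → ℝ, IsWeakSolution p lam u →
      lambdaInner lam u u ≤ B → IsRadial u := by
  obtain ⟨A, hA, hAb⟩ := integral_abs_pow_mul_sq_le ⌈p⌉₊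
  set n := ⌈p⌉₊ + 1
  have hn : p < n := (Nat.le_ceil p).trans_lt (by simp [n])
  set S := A * Real.sqrt B ^ n
  have hS : 0 ≤ S := by positivity
  -- Since `n > p - 2`, the power of `K` tends to `0`. The factor `2 * S` accounts for the two
  -- solutions `u ∘ rot β` and `u`, each contributing `S`.
  obtain ⟨K, hK, hKS⟩ : ∃ K : ℝ, 0 < K ∧ (p - 1) * K ^ (p - 2 - n) * (2 * S) ≤ 1 / 2 := by
    have h1 : Filter.Tendsto (fun K : ℝ => (p - 1) * K ^ (-(n - (p - 2))) * (2 * S))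
        Filter.atTop (nhds ((p - 1) * 0 * (2 * S))) :=
      ((tendsto_rpow_neg_atTop (by linarith)).const_mul _).mul_const _
    rw [mul_zero, zero_mul] at h1
    obtain ⟨K, hK1, hK2⟩ := ((h1.eventually (ge_mem_nhds (by norm_num : (0 : ℝ) < 1 / 2))).and
      (Filter.eventually_gt_atTop 0)).exists
    exact ⟨K, hK2, by rwa [neg_sub] at hK1⟩
  set Q := (p - 1) * K ^ (p - 2)
  have hQ : 0 < Q := mul_pos (by linarith) (by positivity)
  -- With `lam * (Q + 1) < 1` one has `lam < 1` and `lam * Q < 1`, hence `lam ^ 2 * Q ≤ 1`, with no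
  -- square root needed.
  refine ⟨1 / (Q + 1), by positivity, fun lam hlam hlt u hu hB => ?_⟩
  have hlamQ : Q ≤ 1 / lam ^ 2 := by
    have h1 : lam * (Q + 1) < 1 := (lt_div_iff₀ (by positivity)).1 hlt
    rw [le_div_iff₀ (by positivity)]
    have h2 : lam < 1 := by nlinarith
    nlinarith
  refine hu.isRadial_of_forall_lambdaInner_le hlamQ (θ := 1 / 2) (by norm_num) fun β => ?_
  have hur := hu.comp_rot β
  obtain ⟨hi, he⟩ := IsWeakSolution.lambdaInner_sub_self hp hur hu
  have hw := hur.1.sub hu.1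
  obtain ⟨i1, b1⟩ := hAb _ _ hur.1.1 hw.1
  obtain ⟨i2, b2⟩ := hAb _ _ hu.1.1 hw.1
  have hBr : lambdaInner lam (fun x => u (rot β x)) (fun x => u (rot β x)) ≤ B := by
    rwa [lambdaInner_comp_rot hu.1.1 hu.1.1]
  have hbound : ∀ v : Plane → ℝ, MemH v → lambdaInner lam v v ≤ B →
      A * Real.sqrt (h1Sq v) ^ n * h1Sq (fun x => u (rot β x) - u x)
        ≤ S * h1Sq fun x => u (rot β x) - u x := fun v hv hvB => by
    refine mul_le_mul_of_nonneg_right ?_ (h1Sq_nonneg _)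
    have := Real.sqrt_le_sqrt ((hv.h1Sq_le_lambdaInner lam).trans hvB)
    simp only [S]
    gcongr
  replace b1 := b1.trans (hbound _ hur.1 hBr)
  replace b2 := b2.trans (hbound _ hu.1 hB)
  set w : Plane → ℝ := fun x => u (rot β x) - u x
  set κ := (p - 1) * K ^ (p - 2 - n)
  have hκ : 0 ≤ κ := mul_nonneg (by linarith) (by positivity)
  have iw : Integrable (fun x => w x ^ 2) volume := hw.1.1.integrable_sq
  -- The Lipschitz bound is used with `m = max |a| |b|`, then `m ^ (p - 2)` is split at level `K`
  -- and `m ^ n` is bounded by `|a| ^ n + |b| ^ n`.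
  have hpt : ∀ x, (|u (rot β x)| ^ (p - 2) * u (rot β x) - |u x| ^ (p - 2) * u x)
      * (u (rot β x) - u x)
      ≤ Q * w x ^ 2 + κ * (|u (rot β x)| ^ n * w x ^ 2 + |u x| ^ n * w x ^ 2) := fun x => by
    set a := u (rot β x)
    set b := u x
    have h1 := abs_rpow_mul_sub_mul_le (q := p - 2) (a := a) (b := b) (by linarith)
      (le_max_left |a| |b|) (le_max_right |a| |b|)
    rw [show p - 2 + 1 = p - 1 by ring] at h1
    refine h1.trans ?_
    have h2 := rpow_le_add_rpow_mul_pow (t := max |a| |b|) (q := p - 2) (n := n)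
      (le_max_of_le_left (abs_nonneg a)) hK (by linarith) (by linarith)
    have h3 : max |a| |b| ^ n ≤ |a| ^ n + |b| ^ n := by
      rcases max_choice |a| |b| with h | h <;> rw [h]
      · exact le_add_of_nonneg_right (by positivity)
      · exact le_add_of_nonneg_left (by positivity)
    calc (p - 1) * max |a| |b| ^ (p - 2) * (a - b) ^ 2
        ≤ (p - 1) * (K ^ (p - 2) + K ^ (p - 2 - n) * (|a| ^ n + |b| ^ n)) * (a - b) ^ 2 := by
          have hp1 : 0 ≤ p - 1 := by linarith
          gcongr
          exact h2.trans (by gcongr)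
      _ = _ := by simp only [Q, κ, w]; ring
  calc lambdaInner lam w w
      = ∫ x, (|u (rot β x)| ^ (p - 2) * u (rot β x) - |u x| ^ (p - 2) * u x)
          * (u (rot β x) - u x) := he
    _ ≤ ∫ x, (Q * w x ^ 2 + κ * (|u (rot β x)| ^ n * w x ^ 2 + |u x| ^ n * w x ^ 2)) :=
        integral_mono hi ((iw.const_mul Q).add ((i1.add i2).const_mul κ)) hpt
    _ = Q * (∫ x, w x ^ 2) + κ * ((∫ x, |u (rot β x)| ^ n * w x ^ 2)
          + ∫ x, |u x| ^ n * w x ^ 2) := by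
        have i3 : Integrable (fun x => κ * (|u (rot β x)| ^ n * w x ^ 2 + |u x| ^ n * w x ^ 2))
            volume := (i1.add i2).const_mul κ
        rw [integral_add (iw.const_mul Q) i3, integral_const_mul,
          integral_const_mul, integral_add i1 i2]
    _ ≤ Q * (∫ x, w x ^ 2) + κ * (S * h1Sq w + S * h1Sq w) := by gcongr
    _ = Q * (∫ x, w x ^ 2) + κ * (2 * S) * h1Sq w := by ring
    _ ≤ Q * (∫ x, w x ^ 2) + 1 / 2 * h1Sq w := by
        gcongr
        exact h1Sq_nonneg w

theorem rpow_mul_le_of_ofReal_lt {p lam : ℝ} (hp : 2 < p) (hlam : 0 < lam) {M : ℝ≥0∞}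
    (h : ENNReal.ofReal lam < (1 / (ENNReal.ofReal (p - 1) * M ^ (p - 2))) ^ (1 / 2 : ℝ)) :
    M ≠ ⊤ ∧ (p - 1) * M.toReal ^ (p - 2) ≤ 1 / lam ^ 2 := by
  have hp1 : 0 < p - 1 := by linarith
  -- For `M = ⊤` the right-hand side of `h` is `0`, so the strict inequality rules out unbounded
  -- functions.
  have hM : M ≠ ⊤ := by
    rintro rfl
    rw [ENNReal.top_rpow_of_pos (by linarith), ENNReal.mul_top (by simpa using hp1)] at h
    simp at h
  refine ⟨hM, ?_⟩
  set X := (p - 1) * M.toReal ^ (p - 2)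
  have hX0 : 0 ≤ X := by positivity
  have hX : ENNReal.ofReal (p - 1) * M ^ (p - 2) = ENNReal.ofReal X := by
    rw [ENNReal.ofReal_mul hp1.le, ← ENNReal.ofReal_rpow_of_nonneg ENNReal.toReal_nonneg
      (by linarith), ENNReal.ofReal_toReal hM]
  rw [hX] at h
  -- When `X = 0` the bound in `h` is infinite and carries no information, but the conclusion is
  -- then trivial.
  rcases hX0.eq_or_lt with h0 | h0
  · rw [← h0]; positivity
  · rw [one_div, ← ENNReal.ofReal_inv_of_pos h0,
      ENNReal.ofReal_rpow_of_nonneg (by positivity) (by norm_num), ← Real.sqrt_eq_rpow,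
      ENNReal.ofReal_lt_ofReal_iff_of_nonneg hlam.le, Real.lt_sqrt hlam.le] at h
    rw [one_div]
    exact ((lt_inv_comm₀ (by positivity) h0).1 h).le

end Solutions

end SpiralNLS

/-! ### The theorem -/

theorem theorem1p3 (p : ℝ) (hp : 2 < p) :
    (∀ lam : ℝ, 0 < lam → ∀ u : SpiralNLS.Plane → ℝ,
      SpiralNLS.IsWeakSolution p lam u → ¬ u =ᵐ[volume] 0 →
      ENNReal.ofReal lam <
        (1 / (ENNReal.ofReal (p - 1) * eLpNorm u ∞ volume ^ (p - 2))) ^ (1 / 2 : ℝ) →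
      SpiralNLS.IsRadial u) ∧
    (∀ c : ℝ, 0 < c → ∃ lamc : ℝ, 0 < lamc ∧
      ∀ lam : ℝ, 0 < lam → lam < lamc → ∀ u : SpiralNLS.Plane → ℝ,
        SpiralNLS.IsWeakSolution p lam u → SpiralNLS.energy p lam u ≤ c →
        SpiralNLS.IsRadial u) := by
  constructor
  · intro lam hlam u hu _ hlt
    obtain ⟨hM, hle⟩ := SpiralNLS.rpow_mul_le_of_ofReal_lt hp hlam hlt
    refine hu.isRadial_of_ae_abs_le hp ?_ hle
    filter_upwards [ae_le_eLpNormEssSup (f := u) (μ := volume)] with x hx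
    rw [eLpNorm_exponent_top] at hM ⊢
    have := ENNReal.toReal_mono hM hx
    rwa [toReal_enorm, Real.norm_eq_abs] at this
  · intro c _
    obtain ⟨lamc, h0, h⟩ := SpiralNLS.exists_isRadial_of_h1Sq_le hp (c / (1 / 2 - 1 / p))
    exact ⟨lamc, h0, fun lam hlam hlt u hu hc =>
      h lam hlam hlt u hu (SpiralNLS.lambdaInner_self_le_of_energy_le hp hu hc)⟩
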